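/- Let $\Sigma$ be a finite signature consisting of relation and constant symbols, and let $\mathcal C$ be a class of finite $\Sigma$-structures of bounded degree: there is $d\in\mathbb N$ such that for every $\mathcal A\in\mathcal C$ every vertex of the Gaifman graph of $\mathcal A$ (two distinct elements are adjacent iff they occur together in a tuple of some relation of $\mathcal A$) has degree at most $d$. Let $\mathrm C^2$ denote two-variable first-order logic with equality, extended by the counting quantifiers $\exists^{\ge i}x$ and $\exists^{\ge i}y$ ("there are at least $i$ elements such that"), $i\in\mathbb N$. Let $<$ be a binary relation symbol not in $\Sigma$. A sentence $\varphi\in \mathrm C^2(\Sigma\cup\{<\})$ is order-invariant if for every finite $\Sigma$-structure $\mathcal A$ and all strict linear orders $<_0,<_1$ on its universe, $(\mathcal A,<_0)\models\varphi$ iff $(\mathcal A,<_1)\models\varphi$; in that case write $\mathcal A\models\varphi$ iff $(\mathcal A,<_0)\models\varphi$ for some (equivalently, every) strict linear order $<_0$ on the universe of $\mathcal A$. Then every property of $\mathcal C$ definable in order-invariant $\mathrm C^2$ is definable in first-order logic: for every order-invariant sentence $\varphi\in\mathrm C^2(\Sigma\cup\{<\})$ there is a first-order sentence $\psi$ over $\Sigma$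 such that for all $\mathcal A\in\mathcal C$, $\mathcal A\models\varphi$ iff $\mathcal A\models\psi$. -/

import Mathlib

open scoped FirstOrder

universe u v w

namespace OrderInvariant

/-- The relation symbols of the language `{<}`: one binary symbol. -/
inductive LtRel : ℕ → Type
  | lt : LtRel 2

/-- The language `{<}` with a single binary relation symbol. -/
def ltLanguage : FirstOrder.Language.{0, 0} := ⟨fun _ => Empty, LtRel⟩

/-- The language `Σ ∪ {<}`, where `<` is a new symbol. -/
abbrev withLt (L : FirstOrder.Language.{u, v}) : FirstOrder.Language.{u, v} := L.sum ltLanguage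

/-- The interpretation of `<` by the relation `r`. -/
@[reducible] def ltStructure {M : Type w} (r : M → M → Prop) : 
    ltLanguage.Structure M where
  funMap := fun f _ => nomatch f
  RelMap := fun R t => match R, t with
    | LtRel.lt, t => r (t 0) (t 1)

/-- The structure `(M, r)` over `Σ ∪ {<}`, for a structure `M` over `Σ`. -/
@[reducible] def orderExpansion (L : FirstOrder.Language.{u, v}) (M : Type w) [L.Structure M]
    (r : M → M → Prop) : (withLt L).Structure M :=
  letI := ltStructure r
  L.sumStructure ltLanguage M

/-- Formulas of the two-variable logic with counting `C²` over `L`. The two variables are the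
elements of `Fin 2`; they may be reused (requantified) freely. -/
inductive CtwoFormula (L : FirstOrder.Language.{u, v}) : Type (max u v)
  | falsum : CtwoFormula L
  | equal (t₁ t₂ : L.Term (Fin 2)) : CtwoFormula L
  | rel {n : ℕ} (R : L.Relations n) (ts : Fin n → L.Term (Fin 2)) : CtwoFormula L
  | imp (φ ψ : CtwoFormula L) : CtwoFormula L
  | all (x : Fin 2) (φ : CtwoFormula L) : CtwoFormula L
  /-- The counting quantifier: there are at least `i` values of `x` satisfying `φ`. -/
  | existsGE (i : ℕ) (x : Fin 2) (φ : CtwoFormula L) : CtwoFormula L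

namespace CtwoFormula

/-- The set of free variables of a formula. -/
def freeVars {L : FirstOrder.Language.{u, v}} : CtwoFormula L → Finset (Fin 2)
  | falsum => ∅
  | equal t₁ t₂ => t₁.varFinset ∪ t₂.varFinset
  | rel _ ts => Finset.univ.biUnion fun i => (ts i).varFinset
  | imp φ ψ => φ.freeVars ∪ ψ.freeVars
  | all x φ => φ.freeVars.erase x
  | existsGE _ x φ => φ.freeVars.erase x

/-- Truth of a formula in `M` under the assignment `v`. -/
def Realize {L : FirstOrder.Language.{u, v}} {M : Type w} [L.Structure M] :
    CtwoFormula L → (Fin 2 → M) → Prop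
  | falsum, _ => False
  | equal t₁ t₂, v => t₁.realize v = t₂.realize v
  | rel R ts, v => FirstOrder.Language.Structure.RelMap R fun i => (ts i).realize v
  | imp φ ψ, v => φ.Realize v → ψ.Realize v
  | all x φ, v => ∀ a : M, φ.Realize (Function.update v x a)
  | existsGE i x φ, v =>
      ∃ s : Finset M, s.card = i ∧ ∀ a ∈ s, φ.Realize (Function.update v x a)

end CtwoFormula

/-- Sentences of `C²`: formulas without free variables. -/
def CtwoSentence (L : FirstOrder.Language.{u, v}) : Type (max u v) :=
  {φ : CtwoFormula L // φ.freeVars = ∅}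

/-- Truth of a sentence in a (nonempty) structure; the assignment is irrelevant. -/
def CtwoSentence.Realize {L : FirstOrder.Language.{u, v}} (φ : CtwoSentence L) (M : Type w)
    [L.Structure M] : Prop :=
  ∀ v : Fin 2 → M, φ.1.Realize v

/-- Finite structures over `L`, with nonempty universe. -/
structure FinStructure (L : FirstOrder.Language.{u, v}) where
  /-- The universe of the structure. -/
  Carrier : Type w
  [struc : L.Structure Carrier]
  [finite : Finite Carrier]
  [nonempty : Nonempty Carrier]

attribute [instance] FinStructure.struc FinStructure.finite FinStructure.nonempty

/-- The Gaifman graph of a structure: distinct elements are adjacent if they occur in a common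
tuple of some relation. -/
def gaifmanGraph (L : FirstOrder.Language.{u, v}) (M : Type w) [L.Structure M] : SimpleGraph M where
  Adj a b := a ≠ b ∧ ∃ (n : ℕ) (R : L.Relations n) (t : Fin n → M),
    FirstOrder.Language.Structure.RelMap R t ∧ a ∈ Set.range t ∧ b ∈ Set.range t
  symm := ⟨fun _ _ ⟨hne, n, R, t, ht, ha, hb⟩ => ⟨hne.symm, n, R, t, ht, hb, ha⟩⟩
  loopless := ⟨fun _ h => h.1 rfl⟩

/-- A class of finite structures has bounded degree if the Gaifman graphs of its members have
degree at most `d`, for some common `d`. -/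
def BoundedDegree {L : FirstOrder.Language.{u, v}} (C : Set (FinStructure.{u, v, w} L)) : Prop :=
  ∃ d : ℕ, ∀ A ∈ C, ∀ a : A.Carrier, ((gaifmanGraph L A.Carrier).neighborSet a).ncard ≤ d

/-- `(A, r) ⊨ φ`. -/
def RealizeWith {L : FirstOrder.Language.{u, v}} (A : FinStructure.{u, v, w} L)
    (r : A.Carrier → A.Carrier → Prop) (φ : CtwoSentence (withLt L)) : Prop :=
  letI := orderExpansion L A.Carrier r
  φ.Realize A.Carrier

/-- A `C²`-sentence over `Σ ∪ {<}` is order-invariant if its truth value in a finite structure over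
`Σ` never depends on the strict linear order interpreting `<`. -/
def IsOrderInvariant {L : FirstOrder.Language.{u, v}} (φ : CtwoSentence (withLt L)) : Prop :=
  ∀ (A : FinStructure.{u, v, w} L) (r s : A.Carrier → A.Carrier → Prop),
    IsStrictTotalOrder A.Carrier r → IsStrictTotalOrder A.Carrier s →
      (RealizeWith A r φ ↔ RealizeWith A s φ)

/-- Truth of an (order-invariant) sentence in `A`: it holds for every strict linear order. -/
def RealizeInvariantly {L : FirstOrder.Language.{u, v}} (A : FinStructure.{u, v, w} L)
    (φ : CtwoSentence (withLt L)) : Prop :=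
  ∀ r : A.Carrier → A.Carrier → Prop, IsStrictTotalOrder A.Carrier r → RealizeWith A r φ

/-- `P ⊆ C` is definable on `C` in order-invariant `C²`. -/
def DefinableOrderInvariantCtwo {L : FirstOrder.Language.{u, v}} (C P : Set (FinStructure.{u, v, w} L)) :
    Prop :=
  ∃ φ : CtwoSentence (withLt L), IsOrderInvariant.{u, v, w} φ ∧
    P = {A | A ∈ C ∧ RealizeInvariantly A φ}

/-- `P ⊆ C` is definable on `C` in first-order logic. -/
def DefinableFO {L : FirstOrder.Language.{u, v}} (C P : Set (FinStructure.{u, v, w} L)) : Prop :=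
  ∃ ψ : L.Sentence, P = {A | A ∈ C ∧ A.Carrier ⊨ ψ}

end OrderInvariant

/-! Suppose `A` and `B` have bounded degree and agree on enough first-order sentences. It suffices
to find one order on each under which `φ` has the same truth value: order-invariance does the rest,
and a property determined by finitely many sentences is first-order (`definableFO_of_finite`).

The orders are built around a bounded part `X` of `A`, split into levels. Level `0` contains the
constants and all elements whose first-order type is rare; adjacency raises the level by at most
one. Every frequent type gets, in each level up to `K + 3` and on both sides, many scattered copies
of its ball, one family for each possible order of the ball (`exists_layout`). Since `X` is bounded,
the Ehrenfeucht-Fraïssé game copies it into `B`. The left half of `X` becomes an initial segment of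
the order, the right half a final segment, with lower levels further out, in the same way in both
structures; the remaining elements are ordered arbitrarily in between. Whatever ordered ball this
produces around a remaining element, it already occurs many times in each layer of `X`
(`Layout.exists_matching`).

The second player then survives the two-pebble counting game (`Matching.exists_move`). Near the
surviving pebble, and on the low levels, the answer follows a fixed partial isomorphism. A move
elsewhere is answered by a copy of its ordered ball in a layer not yet protected, on the side that
gives the correct order relation to the other pebble. With two variables this is the only order
relation to respect, and there are enough copies to satisfy every counting quantifier of `φ`
(`Matching.realize_iff`). -/

namespace OrderInvariant

open FirstOrder.Language FirstOrder.Language.Structure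

/-! ### Balls in the Gaifman graph. -/

section Near

variable {L : FirstOrder.Language.{u, v}} {A : Type w} [L.Structure A]

/-- `Near L r a b`: the Gaifman distance between `a` and `b` is at most `r`. -/
def Near (L : FirstOrder.Language.{u, v}) {A : Type w} [L.Structure A] : ℕ → A → A → Prop
  | 0, a, b => a = b
  | r + 1, a, b => ∃ c, (c = a ∨ (gaifmanGraph L A).Adj a c) ∧ Near L r c b

theorem Near.refl (r : ℕ) (a : A) : Near L r a a := by
  induction r with
  | zero => rfl
  | succ r ih => exact ⟨a, Or.inl rfl, ih⟩

theorem Near.trans {r s : ℕ} {a b c : A} (h : Near L r a b) (h' : Near L s b c) :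
    Near L (r + s) a c := by
  induction r generalizing a with
  | zero => cases h; simpa using h'
  | succ r ih =>
    obtain ⟨e, he, h⟩ := h
    rw [Nat.succ_add]
    exact ⟨e, he, ih h⟩

theorem Near.mono {r s : ℕ} (hrs : r ≤ s) {a b : A} (h : Near L r a b) : Near L s a b := by
  obtain ⟨k, rfl⟩ := Nat.exists_eq_add_of_le hrs
  exact h.trans (Near.refl k b)

theorem Near.of_adj {a b : A} (h : (gaifmanGraph L A).Adj a b) : Near L 1 a b :=
  ⟨b, Or.inr h, rfl⟩

theorem Near.symm {r : ℕ} {a b : A} (h : Near L r a b) : Near L r b a := by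
  induction r generalizing a with
  | zero => exact Eq.symm h
  | succ r ih =>
    obtain ⟨e, he | he, h⟩ := h
    · subst he; exact (ih h).mono (Nat.le_succ r)
    · exact (ih h).trans (Near.of_adj he.symm)

theorem ncard_near_le [Finite A] {d : ℕ}
    (hd : ∀ a : A, ((gaifmanGraph L A).neighborSet a).ncard ≤ d) (r : ℕ) (a : A) :
    {b | Near L r a b}.ncard ≤ (d + 1) ^ r := by
  classical
  induction r generalizing a with
  | zero => simp [Near]
  | succ r ih =>
    have hfin : (insert a ((gaifmanGraph L A).neighborSet a)).Finite := Set.toFinite _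
    have h1 : {b | Near L (r + 1) a b} ⊆
        ⋃ c ∈ hfin.toFinset, {b | Near L r c b} := by
      rintro b ⟨c, hc, hb⟩
      simp only [Set.mem_iUnion]
      exact ⟨c, by simpa using hc, hb⟩
    refine (Set.ncard_le_ncard h1 (Set.toFinite _)).trans ?_
    refine (Finset.set_ncard_biUnion_le _ _).trans ?_
    refine (Finset.sum_le_card_nsmul _ _ _ fun c _ => ih c).trans ?_
    rw [smul_eq_mul, pow_succ, mul_comm]
    refine Nat.mul_le_mul_left _ ?_
    rw [← Set.ncard_eq_toFinset_card _ hfin]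
    exact (Set.ncard_insert_le _ _).trans (Nat.add_le_add_right (hd a) 1)

end Near

/-! ### Partial isomorphisms and the first-order Ehrenfeucht-Fraïssé game. -/

section PartialIso

variable {L : FirstOrder.Language.{u, v}} {A B D : Type w} [L.Structure A] [L.Structure B]
  [L.Structure D]

/-- The relation `p` preserves and reflects equality and the relations of `L`. -/
def IsPartialIso (L : FirstOrder.Language.{u, v}) {A B : Type w} [L.Structure A] [L.Structure B]
    (p : A → B → Prop) : Prop :=
  (∀ a b a' b', p a b → p a' b' → (a = a' ↔ b = b')) ∧
    ∀ (n : ℕ) (R : L.Relations n) (s : Fin n → A) (t : Fin n → B),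
      (∀ i, p (s i) (t i)) → (RelMap R s ↔ RelMap R t)

theorem IsPartialIso.mono {p q : A → B → Prop} (hq : IsPartialIso L q)
    (hpq : ∀ a b, p a b → q a b) : IsPartialIso L p :=
  ⟨fun a b a' b' h h' => hq.1 a b a' b' (hpq _ _ h) (hpq _ _ h'),
    fun n R s t h => hq.2 n R s t fun i => hpq _ _ (h i)⟩

theorem IsPartialIso.flip {p : A → B → Prop} (hp : IsPartialIso L p) :
    IsPartialIso L (flip p) :=
  ⟨fun _ _ _ _ h h' => (hp.1 _ _ _ _ h h').symm, fun n R s t h => (hp.2 n R t s h).symm⟩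

/-- The relational composition. -/
def comp (p : A → B → Prop) (q : B → D → Prop) (a : A) (c : D) : Prop := ∃ b, p a b ∧ q b c

theorem IsPartialIso.comp {p : A → B → Prop} {q : B → D → Prop} (hp : IsPartialIso L p)
    (hq : IsPartialIso L q) : IsPartialIso L (comp p q) := by
  refine ⟨?_, ?_⟩
  · rintro a c a' c' ⟨b, h1, h2⟩ ⟨b', h1', h2'⟩
    exact (hp.1 _ _ _ _ h1 h1').trans (hq.1 _ _ _ _ h2 h2')
  · intro n R s t h
    choose m hm using h
    exact (hp.2 n R s m fun i => (hm i).1).trans (hq.2 n R m t fun i => (hm i).2)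

/-- All other entries of a tuple through `a` are neighbours of `a`, hence in the domain, so the
whole tuple can be transported. -/
theorem IsPartialIso.adj {p : A → B → Prop} (hp : IsPartialIso L p) {a a' : A} {b b' : B}
    (hab : p a b) (hab' : p a' b')
    (hcov : ∀ c, (gaifmanGraph L A).Adj a c → ∃ c', p c c')
    (h : (gaifmanGraph L A).Adj a a') : (gaifmanGraph L B).Adj b b' := by
  obtain ⟨hne, n, R, t, ht, ⟨i, hi⟩, ⟨i', hi'⟩⟩ := h
  have : ∀ j, ∃ c', p (t j) c' := by
    intro j
    by_cases hj : a = t j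
    · exact ⟨b, hj ▸ hab⟩
    · exact hcov _ ⟨hj, n, R, t, ht, ⟨i, hi⟩, ⟨j, rfl⟩⟩
  choose s hs using this
  refine ⟨fun e => hne ((hp.1 _ _ _ _ hab hab').2 e), n, R, s, (hp.2 n R t s hs).1 ht,
    ⟨i, ?_⟩, ⟨i', ?_⟩⟩
  · exact (hp.1 _ _ _ _ (hs i) hab).1 hi
  · exact (hp.1 _ _ _ _ (hs i') hab').1 hi'

/-- The relation `p` extended by the pair `(a, b)`. -/
def extend (p : A → B → Prop) (a : A) (b : B) (x : A) (y : B) : Prop := p x y ∨ (x = a ∧ y = b)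

/-- The second player survives `n` rounds of the Ehrenfeucht-Fraïssé game from position `p`. -/
def BackForth (L : FirstOrder.Language.{u, v}) {A B : Type w} [L.Structure A] [L.Structure B] :
    ℕ → (A → B → Prop) → Prop
  | 0, p => IsPartialIso L p
  | n + 1, p => IsPartialIso L p ∧ (∀ a, ∃ b, BackForth L n (extend p a b)) ∧
      ∀ b, ∃ a, BackForth L n (extend p a b)

theorem BackForth.isPartialIso {n : ℕ} {p : A → B → Prop} (h : BackForth L n p) :
    IsPartialIso L p := by
  cases n with
  | zero => exact h
  | succ n => exact h.1

theorem BackForth.mono {n : ℕ} {p q : A → B → Prop} (hq : BackForth L n q)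
    (hpq : ∀ a b, p a b → q a b) : BackForth L n p := by
  induction n generalizing p q with
  | zero => exact IsPartialIso.mono hq hpq
  | succ n ih =>
    refine ⟨hq.1.mono hpq, fun a => ?_, fun b => ?_⟩
    · obtain ⟨b, hb⟩ := hq.2.1 a
      exact ⟨b, ih hb fun x y => Or.imp_left (hpq x y)⟩
    · obtain ⟨a, ha⟩ := hq.2.2 b
      exact ⟨a, ih ha fun x y => Or.imp_left (hpq x y)⟩

theorem BackForth.of_le {m n : ℕ} (hmn : m ≤ n) {p : A → B → Prop} (h : BackForth L n p) :
    BackForth L m p := by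
  induction m generalizing n p with
  | zero => exact h.isPartialIso
  | succ m ih =>
    obtain ⟨n, rfl⟩ : ∃ k, n = k + 1 := ⟨n - 1, by omega⟩
    refine ⟨h.1, fun a => ?_, fun b => ?_⟩
    · obtain ⟨b, hb⟩ := h.2.1 a
      exact ⟨b, ih (by omega) hb⟩
    · obtain ⟨a, ha⟩ := h.2.2 b
      exact ⟨a, ih (by omega) ha⟩

theorem BackForth.flip {n : ℕ} {p : A → B → Prop} (h : BackForth L n p) :
    BackForth L n (flip p) := by
  induction n generalizing p with
  | zero => exact IsPartialIso.flip h
  | succ n ih =>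
    have key : ∀ a b, BackForth L n (extend p a b) → BackForth L n (extend (_root_.flip p) b a) :=
      fun a b h => (ih h).mono fun x y => Or.imp_right And.symm
    refine ⟨h.1.flip, fun b => ?_, fun a => ?_⟩
    · obtain ⟨a, ha⟩ := h.2.2 b
      exact ⟨a, key _ _ ha⟩
    · obtain ⟨b, hb⟩ := h.2.1 a
      exact ⟨b, key _ _ hb⟩

theorem BackForth.comp {n : ℕ} {p : A → B → Prop} {q : B → D → Prop} (hp : BackForth L n p)
    (hq : BackForth L n q) : BackForth L n (comp p q) := by
  induction n generalizing p q with
  | zero => exact IsPartialIso.comp hp hq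
  | succ n ih =>
    have key : ∀ a b c, BackForth L n (extend p a b) → BackForth L n (extend q b c) →
        BackForth L n (extend (OrderInvariant.comp p q) a c) := by
      intro a b c h h'
      refine (ih h h').mono ?_
      rintro x y (⟨z, h1, h2⟩ | ⟨rfl, rfl⟩)
      · exact ⟨z, Or.inl h1, Or.inl h2⟩
      · exact ⟨b, Or.inr ⟨rfl, rfl⟩, Or.inr ⟨rfl, rfl⟩⟩
    refine ⟨hp.1.comp hq.1, fun a => ?_, fun c => ?_⟩
    · obtain ⟨b, hb⟩ := hp.2.1 a
      obtain ⟨c, hc⟩ := hq.2.1 b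
      exact ⟨c, key _ _ _ hb hc⟩
    · obtain ⟨b, hb⟩ := hq.2.2 c
      obtain ⟨a, ha⟩ := hp.2.2 b
      exact ⟨a, key _ _ _ ha hb⟩

theorem BackForth.exists_fun [Nonempty B] {n : ℕ} (s : Finset A) {k : ℕ} (hs : s.card ≤ k)
    {p : A → B → Prop} (h : BackForth L (k + n) p) :
    ∃ f : A → B, BackForth L n (fun a b => p a b ∨ (a ∈ s ∧ b = f a)) := by
  classical
  induction s using Finset.induction_on generalizing k p with
  | empty =>
    exact ⟨fun _ => Classical.arbitrary B, (h.of_le (Nat.le_add_left n k)).mono (by simp)⟩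
  | insert a s ha ih =>
    rw [Finset.card_insert_of_notMem ha] at hs
    obtain ⟨k, rfl⟩ : ∃ j, k = j + 1 := ⟨k - 1, by omega⟩
    rw [Nat.succ_add] at h
    obtain ⟨b, hb⟩ := h.2.1 a
    obtain ⟨f, hf⟩ := ih (by omega) hb
    refine ⟨Function.update f a b, hf.mono ?_⟩
    rintro x y (h | ⟨hx, rfl⟩)
    · exact Or.inl (Or.inl h)
    · rcases Finset.mem_insert.1 hx with rfl | hx'
      · exact Or.inl (Or.inr ⟨rfl, by simp⟩)
      · exact Or.inr ⟨hx', by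
          rw [Function.update_of_ne]
          rintro rfl
          exact ha hx'⟩

/-- Adjacency is witnessed by a tuple of length at most `m`; playing its entries uses `m` rounds. -/
theorem BackForth.adj [Nonempty B] {m n : ℕ} (hm : ∀ k, Nonempty (L.Relations k) → k ≤ m)
    (hmn : m ≤ n) {p : A → B → Prop} (h : BackForth L n p) {a a' : A} {b b' : B} (hab : p a b)
    (hab' : p a' b') (hadj : (gaifmanGraph L A).Adj a a') : (gaifmanGraph L B).Adj b b' := by
  classical
  obtain ⟨hne, k, R, t, ht, ⟨i, hi⟩, ⟨i', hi'⟩⟩ := hadj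
  have hcard : (Finset.univ.image t).card ≤ m :=
    (Finset.card_image_le.trans (by simp)).trans (hm k ⟨R⟩)
  obtain ⟨f, hf⟩ := BackForth.exists_fun (n := 0) _ hcard (h.of_le hmn)
  have hf := hf.isPartialIso
  refine ⟨fun e => hne ((h.isPartialIso.1 _ _ _ _ hab hab').2 e), k, R, f ∘ t,
    (hf.2 k R t (f ∘ t) fun i => Or.inr ⟨by simp, rfl⟩).1 ht, ⟨i, ?_⟩, ⟨i', ?_⟩⟩
  · exact (hf.1 _ _ _ _ (Or.inr ⟨by simp, rfl⟩) (Or.inl hab)).1 hi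
  · exact (hf.1 _ _ _ _ (Or.inr ⟨by simp, rfl⟩) (Or.inl hab')).1 hi'

/-- The reply to `b'` is a neighbour of `a`, so it is already in the domain of `p`, and injectivity
puts the new pair in `p` itself. -/
theorem BackForth.exists_adj [Nonempty A] {m n : ℕ}
    (hm : ∀ k, Nonempty (L.Relations k) → k ≤ m) (hmn : m + 1 ≤ n) {p : A → B → Prop}
    (h : BackForth L n p) {a : A} {b : B} (hab : p a b)
    (hcov : ∀ c, (gaifmanGraph L A).Adj a c → ∃ c', p c c') {b' : B}
    (hadj : (gaifmanGraph L B).Adj b b') :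
    ∃ a', p a' b' ∧ (gaifmanGraph L A).Adj a a' := by
  obtain ⟨a', ha'⟩ := (h.of_le hmn).2.2 b'
  have hadj' : (gaifmanGraph L A).Adj a a' :=
    ha'.flip.adj hm le_rfl (Or.inl hab) (Or.inr ⟨rfl, rfl⟩) hadj
  obtain ⟨c', hc'⟩ := hcov _ hadj'
  have := (ha'.isPartialIso.1 _ _ _ _ (Or.inl hc') (Or.inr ⟨rfl, rfl⟩)).1 rfl
  exact ⟨a', this ▸ hc', hadj'⟩

theorem BackForth.exists_near [Nonempty A] {m n r : ℕ}
    (hm : ∀ k, Nonempty (L.Relations k) → k ≤ m) (hmn : m + 1 ≤ n) {p : A → B → Prop}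
    (h : BackForth L n p) {a : A} {b : B} (hab : p a b)
    (hcov : ∀ c, Near L r a c → ∃ c', p c c') {b' : B} (hb : Near L r b b') :
    ∃ a', p a' b' ∧ Near L r a a' := by
  induction r generalizing a b with
  | zero => cases hb; exact ⟨a, hab, rfl⟩
  | succ r ih =>
    obtain ⟨c, hc | hc, hb⟩ := hb
    · subst hc
      obtain ⟨a', h1, h2⟩ := ih hab (fun c hc => hcov c (hc.mono (Nat.le_succ r))) hb
      exact ⟨a', h1, h2.mono (Nat.le_succ r)⟩
    · obtain ⟨e, he, hae⟩ := h.exists_adj hm hmn hab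
        (fun e he => hcov e ((Near.of_adj he).mono (by omega))) hc
      obtain ⟨a', h1, h2⟩ := ih he (fun c hc => hcov c ⟨e, Or.inr hae, hc⟩) hb
      exact ⟨a', h1, e, Or.inr hae, h2⟩

end PartialIso

/-! ### Finitely many first-order formulas control the game. -/

section Types

variable {L : FirstOrder.Language.{u, v}}

/-- The pairs of values of a constant symbol in two structures. -/
def constRel (L : FirstOrder.Language.{u, v}) (A B : Type w) [L.Structure A] [L.Structure B]
    (a : A) (b : B) : Prop := ∃ c : L.Constants, a = c ∧ b = c

theorem exists_finite_atomic (hfin : Finite L.Symbols) (k : ℕ) :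
    ∃ S : Set (L.BoundedFormula Empty k), S.Finite ∧
      ∀ (A B : Type w) [L.Structure A] [L.Structure B] (s : Fin k → A) (t : Fin k → B),
        (∀ θ ∈ S, θ.Realize default s ↔ θ.Realize default t) →
          IsPartialIso L fun a b => constRel L A B a b ∨ ∃ i, a = s i ∧ b = t i := by
  have : Finite L.Constants := Finite.of_injective
    (fun c => (Sum.inl ⟨0, c⟩ : L.Symbols)) (fun c c' h => by simpa using h)
  have : Finite (Σ n, L.Relations n) := Finite.of_injective
    (fun c => (Sum.inr c : L.Symbols)) Sum.inr_injective
  let tm : L.Constants ⊕ Fin k → L.Term (Empty ⊕ Fin k) :=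
    Sum.elim (fun c => c.term) fun i => Term.var (Sum.inr i)
  refine ⟨Set.range (fun q : (L.Constants ⊕ Fin k) × (L.Constants ⊕ Fin k) =>
      Term.bdEqual (tm q.1) (tm q.2)) ∪
    Set.range (fun q : (Σ R : (Σ n, L.Relations n), Fin R.1 → L.Constants ⊕ Fin k) =>
      q.1.2.boundedFormula fun i => tm (q.2 i)),
    (Set.finite_range _).union (Set.finite_range _), ?_⟩
  intro A B _ _ s t h
  have hval : ∀ (a : A) (b : B), (constRel L A B a b ∨ ∃ i, a = s i ∧ b = t i) →
      ∃ q, (tm q).realize (Sum.elim default s) = a ∧ (tm q).realize (Sum.elim default t) = b := by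
    rintro a b (⟨c, rfl, rfl⟩ | ⟨i, rfl, rfl⟩)
    · exact ⟨Sum.inl c, by simp [tm], by simp [tm]⟩
    · exact ⟨Sum.inr i, by simp [tm], by simp [tm]⟩
  refine ⟨?_, ?_⟩
  · intro a b a' b' hab hab'
    obtain ⟨q, rfl, rfl⟩ := hval _ _ hab
    obtain ⟨q', rfl, rfl⟩ := hval _ _ hab'
    simpa using h _ (Or.inl ⟨(q, q'), rfl⟩)
  · intro n R x y hxy
    choose q hq using fun i => hval _ _ (hxy i)
    have := h _ (Or.inr ⟨⟨⟨n, R⟩, q⟩, rfl⟩)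
    simp only [BoundedFormula.realize_rel, hq] at this
    exact this

/-- The formula saying that the members of `S` that hold are exactly those of `X`. -/
noncomputable def typeFormula {k : ℕ} (S : Set (L.BoundedFormula Empty k)) [Finite S] (X : Set S) :
    L.BoundedFormula Empty k :=
  open Classical in
  BoundedFormula.iInf fun θ : S => if θ ∈ X then θ.1 else θ.1.not

theorem realize_typeFormula {k : ℕ} {S : Set (L.BoundedFormula Empty k)} [Finite S] {X : Set S}
    {A : Type w} [L.Structure A] {s : Fin k → A} :
    (typeFormula S X).Realize default s ↔ ∀ θ : S, (θ.1.Realize default s ↔ θ ∈ X) := by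
  classical
  rw [typeFormula, BoundedFormula.realize_iInf]
  refine forall_congr' fun θ => ?_
  by_cases h : θ ∈ X <;> simp [h]

/-- Hintikka's argument: over a finite set of formulas there are finitely many types, and the next
set records which types of a one-point extension are realized. -/
theorem exists_finite_backForth (hfin : Finite L.Symbols) (n k : ℕ) :
    ∃ S : Set (L.BoundedFormula Empty k), S.Finite ∧
      ∀ (A B : Type w) [L.Structure A] [L.Structure B] (s : Fin k → A) (t : Fin k → B),
        (∀ θ ∈ S, θ.Realize default s ↔ θ.Realize default t) →
          BackForth L n fun a b => constRel L A B a b ∨ ∃ i, a = s i ∧ b = t i := by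
  induction n generalizing k with
  | zero => exact exists_finite_atomic hfin k
  | succ n ih =>
    obtain ⟨S₀, hS₀, h₀⟩ := exists_finite_atomic.{u, v, w} hfin k
    obtain ⟨S, hS, h⟩ := ih (k + 1)
    have := hS.to_subtype
    refine ⟨S₀ ∪ Set.range fun X : Set S => (typeFormula S X).ex,
      hS₀.union (Set.finite_range _), ?_⟩
    have half : ∀ (A B : Type w) [L.Structure A] [L.Structure B] (s : Fin k → A) (t : Fin k → B),
        (∀ θ ∈ S₀ ∪ Set.range fun X : Set S => (typeFormula S X).ex,
          θ.Realize default s ↔ θ.Realize default t) → ∀ a, ∃ b,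
          BackForth L n (extend (fun a b => constRel L A B a b ∨ ∃ i, a = s i ∧ b = t i) a b) := by
      intro A B _ _ s t hst a
      have hX := hst _ (Or.inr ⟨{θ : S | θ.1.Realize default (Fin.snoc s a)}, rfl⟩)
      simp only [BoundedFormula.realize_ex, realize_typeFormula] at hX
      obtain ⟨b, hb⟩ := hX.1 ⟨a, fun θ => Iff.rfl⟩
      refine ⟨b, (h A B (Fin.snoc s a) (Fin.snoc t b) fun θ hθ => (hb ⟨θ, hθ⟩).symm).mono ?_⟩
      rintro x y ((hc | ⟨i, rfl, rfl⟩) | ⟨rfl, rfl⟩)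
      · exact Or.inl hc
      · exact Or.inr ⟨i.castSucc, by simp, by simp⟩
      · exact Or.inr ⟨Fin.last k, by simp, by simp⟩
    intro A B _ _ s t hst
    refine ⟨h₀ A B s t fun θ hθ => hst θ (Or.inl hθ), half A B s t hst, fun b => ?_⟩
    obtain ⟨a, ha⟩ := half B A t s (fun θ hθ => (hst θ hθ).symm) b
    refine ⟨a, ha.flip.mono ?_⟩
    rintro x y ((⟨c, rfl, rfl⟩ | ⟨i, rfl, rfl⟩) | ⟨rfl, rfl⟩)
    · exact Or.inl (Or.inl ⟨c, rfl, rfl⟩)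
    · exact Or.inl (Or.inr ⟨i, rfl, rfl⟩)
    · exact Or.inr ⟨rfl, rfl⟩

theorem definableFO_of_finite {C P : Set (FinStructure.{u, v, w} L)} (hP : P ⊆ C)
    {S : Set L.Sentence} (hS : S.Finite)
    (h : ∀ A ∈ C, ∀ B ∈ C, (∀ θ ∈ S, A.Carrier ⊨ θ ↔ B.Carrier ⊨ θ) → A ∈ P → B ∈ P) :
    DefinableFO C P := by
  have := hS.to_subtype
  let ty : FinStructure.{u, v, w} L → Set S := fun A => {θ | A.Carrier ⊨ θ.1}
  -- The defining sentence is the finite disjunction of the complete `S`-types realized in `P`.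
  refine ⟨BoundedFormula.iSup fun X : ty '' P => typeFormula S X.1, ?_⟩
  ext B
  simp only [Set.mem_ofPred_eq, Sentence.Realize, Formula.Realize, BoundedFormula.realize_iSup,
    realize_typeFormula]
  constructor
  · exact fun hB => ⟨hP hB, ⟨_, B, hB, rfl⟩, fun θ => Iff.rfl⟩
  · rintro ⟨hBC, ⟨_, A, hA, rfl⟩, hX⟩
    exact h A (hP hA) B hBC (fun θ hθ => (hX ⟨θ, hθ⟩).symm) hA

end Types

/-! ### The two-pebble counting game on matched ordered structures. -/

section Game

variable {L : FirstOrder.Language.{u, v}} {A B : Type w} [L.Structure A] [L.Structure B]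

/-- A partial isomorphism that also preserves and reflects the order. -/
def IsOrderedPartialIso (L : FirstOrder.Language.{u, v}) {A B : Type w} [L.Structure A]
    [L.Structure B] (r : A → A → Prop) (s : B → B → Prop) (p : A → B → Prop) : Prop :=
  IsPartialIso L p ∧ ∀ a b a' b', p a b → p a' b' → (r a a' ↔ s b b')

variable {r : A → A → Prop} {s : B → B → Prop}

theorem IsOrderedPartialIso.mono {p q : A → B → Prop} (hq : IsOrderedPartialIso L r s q)
    (hpq : ∀ a b, p a b → q a b) : IsOrderedPartialIso L r s p :=
  ⟨hq.1.mono hpq, fun a b a' b' h h' => hq.2 a b a' b' (hpq _ _ h) (hpq _ _ h')⟩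

theorem IsOrderedPartialIso.flip {p : A → B → Prop} (hp : IsOrderedPartialIso L r s p) :
    IsOrderedPartialIso L s r (flip p) :=
  ⟨hp.1.flip, fun _ _ _ _ h h' => (hp.2 _ _ _ _ h h').symm⟩

/-- The relation consisting of the pairs `(a, b)` and `(a', b')`. -/
def pairRel (a : A) (b : B) (a' : A) (b' : B) (x : A) (y : B) : Prop :=
  (x = a ∧ y = b) ∨ (x = a' ∧ y = b')

theorem adj_of_relMap {n : ℕ} {R : L.Relations n} {t : Fin n → A} (h : RelMap R t) {i j : Fin n}
    (hij : t i ≠ t j) : (gaifmanGraph L A).Adj (t i) (t j) :=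
  ⟨hij, n, R, t, h, ⟨i, rfl⟩, ⟨j, rfl⟩⟩

/-- A related tuple containing both pebbles would make them adjacent, so every relation among the
pebbles concerns a single pebble. -/
theorem isOrderedPartialIso_pairRel {a a' : A} {b b' : B} {p p' : A → B → Prop}
    (hp : IsOrderedPartialIso L r s p) (hp' : IsOrderedPartialIso L r s p') (h : p a b)
    (h' : p' a' b') (hne : a ≠ a') (hne' : b ≠ b') (hadj : ¬ (gaifmanGraph L A).Adj a a')
    (hadj' : ¬ (gaifmanGraph L B).Adj b b') (h1 : r a a' ↔ s b b') (h2 : r a' a ↔ s b' b) :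
    IsOrderedPartialIso L r s (pairRel a b a' b') := by
  refine ⟨⟨?_, ?_⟩, ?_⟩
  · rintro _ _ _ _ (⟨rfl, rfl⟩ | ⟨rfl, rfl⟩) (⟨rfl, rfl⟩ | ⟨rfl, rfl⟩)
    · simp
    · simp [hne, hne']
    · simp [hne.symm, hne'.symm]
    · simp
  · intro n R x y hxy
    by_cases hall : ∀ i, x i = a ∧ y i = b
    · exact hp.1.2 n R x y fun i => by rw [(hall i).1, (hall i).2]; exact h
    by_cases hall' : ∀ i, x i = a' ∧ y i = b'
    · exact hp'.1.2 n R x y fun i => by rw [(hall' i).1, (hall' i).2]; exact h'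
    push Not at hall hall'
    obtain ⟨i, hi⟩ := hall
    obtain ⟨j, hj⟩ := hall'
    obtain ⟨hi1, hi2⟩ := (hxy i).resolve_left fun h => hi h.1 h.2
    obtain ⟨hj1, hj2⟩ := (hxy j).resolve_right fun h => hj h.1 h.2
    constructor
    · intro hR
      have := adj_of_relMap hR (i := j) (j := i) (by rwa [hi1, hj1])
      rw [hi1, hj1] at this
      exact absurd this hadj
    · intro hR
      have := adj_of_relMap hR (i := j) (j := i) (by rwa [hi2, hj2])
      rw [hi2, hj2] at this
      exact absurd this hadj'
  · rintro _ _ _ _ (⟨rfl, rfl⟩ | ⟨rfl, rfl⟩) (⟨rfl, rfl⟩ | ⟨rfl, rfl⟩)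
    · exact hp.2 _ _ _ _ h h
    · exact h1
    · exact h2
    · exact hp'.2 _ _ _ _ h' h'

/-- Some ordered partial isomorphism maps `a` to `b` and covers the balls of radius `j` around
them. -/
def LocalIso (L : FirstOrder.Language.{u, v}) {A B : Type w} [L.Structure A] [L.Structure B]
    (r : A → A → Prop) (s : B → B → Prop) (j : ℕ) (a : A) (b : B) : Prop :=
  ∃ p : A → B → Prop, p a b ∧ IsOrderedPartialIso L r s p ∧
    (∀ a', Near L j a a' → ∃ b', p a' b') ∧ ∀ b', Near L j b b' → ∃ a', p a' b'

theorem LocalIso.flip {j : ℕ} {a : A} {b : B} (h : LocalIso L r s j a b) :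
    LocalIso L s r j b a := by
  obtain ⟨p, h1, h2, h3, h4⟩ := h
  exact ⟨_root_.flip p, h1, h2.flip, h4, h3⟩

theorem LocalIso.mono {j k : ℕ} (hjk : j ≤ k) {a : A} {b : B} (h : LocalIso L r s k a b) :
    LocalIso L r s j a b := by
  obtain ⟨p, h1, h2, h3, h4⟩ := h
  exact ⟨p, h1, h2, fun a' ha => h3 a' (ha.mono hjk), fun b' hb => h4 b' (hb.mono hjk)⟩

/-- Common initial and final segments of two ordered structures, indexed by `ι` and layered by
`lev`, such that the local ordered types outside occur often in each layer. Fields ending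
in `x` concern `A`, those ending in `y` concern `B`. -/
structure Matching (L : FirstOrder.Language.{u, v}) {A B : Type w} [L.Structure A] [L.Structure B]
    (r : A → A → Prop) (s : B → B → Prop) (K N d : ℕ) {ι : Type w} (x : ι → A) (y : ι → B)
    (lev : ι → ℕ) (left : ι → Prop) : Prop where
  order_x : IsStrictTotalOrder A r
  order_y : IsStrictTotalOrder B s
  degree_x : ∀ a : A, ((gaifmanGraph L A).neighborSet a).ncard ≤ d
  degree_y : ∀ b : B, ((gaifmanGraph L B).neighborSet b).ncard ≤ d
  injective : Function.Injective x
  iso : IsOrderedPartialIso L r s fun a b => ∃ i, x i = a ∧ y i = b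
  const : ∀ c : L.Constants, ∃ i, lev i = 0 ∧ x i = c ∧ y i = c
  -- The strategy enters levels up to `K + 3` and inspects balls of radius at most `K`, so `2 * K +
  -- 3` levels keep these balls inside the index set.
  closed_x : ∀ i a, lev i < 2 * K + 3 → (gaifmanGraph L A).Adj (x i) a →
    ∃ i', x i' = a ∧ lev i' ≤ lev i + 1
  closed_y : ∀ i b, lev i < 2 * K + 3 → (gaifmanGraph L B).Adj (y i) b →
    ∃ i', y i' = b ∧ lev i' ≤ lev i + 1
  left_x : ∀ i a, left i → (∀ i', lev i' ≤ lev i → x i' ≠ a) → r (x i) a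
  left_y : ∀ i b, left i → (∀ i', lev i' ≤ lev i → y i' ≠ b) → s (y i) b
  right_x : ∀ i a, ¬ left i → (∀ i', lev i' ≤ lev i → x i' ≠ a) → r a (x i)
  right_y : ∀ i b, ¬ left i → (∀ i', lev i' ≤ lev i → y i' ≠ b) → s b (y i)
  -- The surplus `d` allows the copies adjacent to the other pebble to be discarded while `N`
  -- remain.
  rich_x : ∀ a, (∀ i, lev i = 0 → x i ≠ a) → ∀ l ≤ K + 3, ∀ S : Prop, ∃ F : Finset ι,
    N + d ≤ F.card ∧ ∀ i ∈ F, lev i = l ∧ (left i ↔ S) ∧ LocalIso L r s K a (y i)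
  rich_y : ∀ b, (∀ i, lev i = 0 → y i ≠ b) → ∀ l ≤ K + 3, ∀ S : Prop, ∃ F : Finset ι,
    N + d ≤ F.card ∧ ∀ i ∈ F, lev i = l ∧ (left i ↔ S) ∧ LocalIso L s r K b (x i)

namespace Matching

variable {K N d : ℕ} {ι : Type w} {x : ι → A} {y : ι → B} {lev : ι → ℕ} {left : ι → Prop}

theorem symm (M : Matching L r s K N d x y lev left) : Matching L s r K N d y x lev left where
  order_x := M.order_y
  order_y := M.order_x
  degree_x := M.degree_y
  degree_y := M.degree_x
  injective := fun i j h => M.injective ((M.iso.1.1 _ _ _ _ ⟨i, rfl, rfl⟩ ⟨j, rfl, rfl⟩).2 h)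
  iso := M.iso.flip.mono fun _ _ ⟨i, h1, h2⟩ => ⟨i, h2, h1⟩
  const := fun c => let ⟨i, h, h1, h2⟩ := M.const c; ⟨i, h, h2, h1⟩
  closed_x := M.closed_y
  closed_y := M.closed_x
  left_x := M.left_y
  left_y := M.left_x
  right_x := M.right_y
  right_y := M.right_x
  rich_x := M.rich_y
  rich_y := M.rich_x

theorem near_closed (M : Matching L r s K N d x y lev left) {j : ℕ} {i : ι} {a : A}
    (hi : lev i + j ≤ 2 * K + 3) (h : Near L j (x i) a) : ∃ i', x i' = a := by
  induction j generalizing i with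
  | zero => exact ⟨i, h⟩
  | succ j ih =>
    obtain ⟨c, rfl | hc, h⟩ := h
    · exact ih (by omega) h
    · obtain ⟨i', rfl, hi'⟩ := M.closed_x i c (by omega) hc
      exact ih (by omega) h

theorem localIso (M : Matching L r s K N d x y lev left) {j : ℕ} {i : ι}
    (hi : lev i + j ≤ 2 * K + 3) : LocalIso L r s j (x i) (y i) := by
  refine ⟨_, ⟨i, rfl, rfl⟩, M.iso, fun a' ha => ?_, fun b' hb => ?_⟩
  · obtain ⟨i', rfl⟩ := M.near_closed hi ha
    exact ⟨_, i', rfl, rfl⟩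
  · obtain ⟨i', rfl⟩ := M.symm.near_closed hi hb
    exact ⟨_, i', rfl, rfl⟩

end Matching

/-- The winning condition for a pair of pebbles when `j` rounds remain. -/
def Good (L : FirstOrder.Language.{u, v}) {A B : Type w} [L.Structure A] [L.Structure B]
    (r : A → A → Prop) (s : B → B → Prop) {ι : Type w} (x : ι → A) (y : ι → B)
    (lev : ι → ℕ) (j : ℕ) (a : A) (b : B) : Prop :=
  (∃ i, lev i ≤ j + 1 ∧ x i = a ∧ y i = b) ∨
    ((∀ i, lev i ≤ j + 1 → x i ≠ a) ∧ (∀ i, lev i ≤ j + 1 → y i ≠ b) ∧ LocalIso L r s j a b)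

namespace Matching

variable {K N d : ℕ} {ι : Type w} {x : ι → A} {y : ι → B} {lev : ι → ℕ} {left : ι → Prop}

theorem good_symm {j : ℕ} {a : A} {b : B} (h : Good L r s x y lev j a b) :
    Good L s r y x lev j b a := by
  obtain ⟨i, h1, h2, h3⟩ | ⟨h1, h2, h3⟩ := h
  · exact Or.inl ⟨i, h1, h3, h2⟩
  · exact Or.inr ⟨h2, h1, h3.flip⟩

theorem good_index (M : Matching L r s K N d x y lev left) {j : ℕ} {i : ι}
    (hi : lev i + j ≤ 2 * K + 3) : Good L r s x y lev j (x i) (y i) := by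
  by_cases h : lev i ≤ j + 1
  · exact Or.inl ⟨i, h, rfl, rfl⟩
  · refine Or.inr ⟨fun i' h1 h2 => h ?_, fun i' h1 h2 => h ?_, M.localIso hi⟩
    · rwa [← M.injective h2]
    · rwa [← M.symm.injective h2]

theorem good_of_succ (M : Matching L r s K N d x y lev left) {j : ℕ} (hj : j + 1 ≤ K) {a : A}
    {b : B} (h : Good L r s x y lev (j + 1) a b) : Good L r s x y lev j a b := by
  obtain ⟨i, h1, rfl, rfl⟩ | ⟨h1, h2, h3⟩ := h
  · exact M.good_index (by omega)
  · exact Or.inr ⟨fun i hi => h1 i (by omega), fun i hi => h2 i (by omega),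
      h3.mono (Nat.le_succ j)⟩

theorem exists_iso_of_good (M : Matching L r s K N d x y lev left) {j : ℕ} {a : A} {b : B}
    (h : Good L r s x y lev j a b) : ∃ p, IsOrderedPartialIso L r s p ∧ p a b := by
  obtain ⟨i, h1, h2, h3⟩ | ⟨h1, h2, p, h3, h4, -⟩ := h
  · exact ⟨_, M.iso, i, h2, h3⟩
  · exact ⟨p, h4, h3⟩

theorem not_adj_x (M : Matching L r s K N d x y lev left) {i : ι} {j : ℕ} {a : A}
    (hi : lev i ≤ j) (hj : j ≤ 2 * K + 2) (ha : ∀ i, lev i ≤ j + 1 → x i ≠ a) :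
    ¬ (gaifmanGraph L A).Adj (x i) a := by
  intro h
  obtain ⟨i', h1, h2⟩ := M.closed_x i a (by omega) h
  exact ha i' (by omega) h1

theorem lt_iff_lt (M : Matching L r s K N d x y lev left) {i : ι} {a : A} {b : B}
    (ha : ∀ i', lev i' ≤ lev i → x i' ≠ a) (hb : ∀ i', lev i' ≤ lev i → y i' ≠ b) :
    (r (x i) a ↔ s (y i) b) ∧ (r a (x i) ↔ s b (y i)) := by
  have := M.order_x
  have := M.order_y
  by_cases hl : left i
  · have h1 := M.left_x i a hl ha
    have h2 := M.left_y i b hl hb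
    exact ⟨iff_of_true h1 h2, iff_of_false (asymm_of r h1) (asymm_of s h2)⟩
  · have h1 := M.right_x i a hl ha
    have h2 := M.right_y i b hl hb
    exact ⟨iff_of_false (asymm_of r h1) (asymm_of s h2), iff_of_true h1 h2⟩

/-- Many answers to a move that is far from the other pebble. -/
theorem exists_answers (M : Matching L r s K N d x y lev left) [Finite B] {j l : ℕ} {a a' : A}
    {b : B} (hj : j ≤ K) (hl : l ≤ K + 3) (hlj : j + 1 < l) {p : A → B → Prop}
    (hp : IsOrderedPartialIso L r s p) (hab : p a b)
    (ha' : ∀ i, lev i ≤ j + 1 → x i ≠ a') (hne : a ≠ a') (hadj : ¬ (gaifmanGraph L A).Adj a a')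
    (hne' : ∀ i, lev i = l → y i ≠ b)
    (hS : ∃ S : Prop, ∀ i, lev i = l → (left i ↔ S) →
      ((r a a' ↔ s b (y i)) ∧ (r a' a ↔ s (y i) b))) :
    ∃ F : Finset B, N ≤ F.card ∧ ∀ b' ∈ F, Good L r s x y lev j a' b' ∧
      IsOrderedPartialIso L r s (pairRel a b a' b') := by
  classical
  obtain ⟨S, hS⟩ := hS
  obtain ⟨F, hF, hF'⟩ := M.rich_x a' (fun i hi => ha' i (by omega)) l hl S
  have hcard : (F.image y).card = F.card := Finset.card_image_of_injective _ M.symm.injective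
  have hfin : ((gaifmanGraph L B).neighborSet b).Finite := Set.toFinite _
  refine ⟨F.image y \ hfin.toFinset, ?_, ?_⟩
  · have h1 := Finset.le_card_sdiff hfin.toFinset (F.image y)
    have h2 := M.degree_y b
    rw [Set.ncard_eq_toFinset_card _ hfin] at h2
    omega
  · intro b' hb'
    simp only [Finset.mem_sdiff, Finset.mem_image, Set.Finite.mem_toFinset,
      SimpleGraph.mem_neighborSet] at hb'
    obtain ⟨⟨i, hi, rfl⟩, hb'⟩ := hb'
    obtain ⟨h1, h2, h3⟩ := hF' i hi
    refine ⟨Or.inr ⟨ha', fun i' h h' => ?_, h3.mono hj⟩, ?_⟩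
    · have := M.symm.injective h'
      subst this
      omega
    · obtain ⟨p', hp', hp2, -⟩ := h3
      have := hS i h1 h2
      exact isOrderedPartialIso_pairRel hp hp2 hab hp' hne (hne' i h1).symm hadj hb'
        this.1 this.2

/-- The relation `m` holds the forced answers and is injective; every other move has `N`
interchangeable answers. The levels protected by `Good` shrink with `j`, so each round has a fresh
layer from which to take those answers. -/
theorem exists_move (M : Matching L r s K N d x y lev left) [Finite B] {j : ℕ} (hj : j + 1 ≤ K)
    {a : A} {b : B} (h : Good L r s x y lev (j + 1) a b) :
    ∃ m : A → B → Prop, (∀ a₁ a₂ b', m a₁ b' → m a₂ b' → a₁ = a₂) ∧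
      (∀ a' b', m a' b' → Good L r s x y lev j a' b' ∧
        IsOrderedPartialIso L r s (pairRel a b a' b')) ∧
      ∀ a', (∃ b', m a' b') ∨ ∃ F : Finset B, N ≤ F.card ∧ ∀ b' ∈ F,
        Good L r s x y lev j a' b' ∧ IsOrderedPartialIso L r s (pairRel a b a' b') := by
  have := M.order_x
  have := M.order_y
  have pair : ∀ {p : A → B → Prop}, IsOrderedPartialIso L r s p → p a b → ∀ {a' b'}, p a' b' →
      IsOrderedPartialIso L r s (pairRel a b a' b') := by
    intro p hp hab a' b' hab'
    exact hp.mono fun u v => by rintro (⟨rfl, rfl⟩ | ⟨rfl, rfl⟩) <;> assumption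
  obtain ⟨i, hi, rfl, rfl⟩ | ⟨ha, hb, p, hab, hp, hpA, hpB⟩ := h
  -- The surviving pebble has level at most `j + 2`, so levels up to `j + 3` contain all its
  -- neighbours.
  · refine ⟨fun a' b' => ∃ i, lev i ≤ j + 3 ∧ x i = a' ∧ y i = b', ?_, ?_, ?_⟩
    · rintro _ _ _ ⟨i₁, -, rfl, rfl⟩ ⟨i₂, -, rfl, h⟩
      rw [M.symm.injective h]
    · rintro _ _ ⟨i', hi', rfl, rfl⟩
      exact ⟨M.good_index (by omega), pair M.iso ⟨i, rfl, rfl⟩ ⟨i', rfl, rfl⟩⟩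
    · intro a'
      by_cases ha' : ∃ i, lev i ≤ j + 3 ∧ x i = a'
      · obtain ⟨i', h1, h2⟩ := ha'
        exact Or.inl ⟨y i', i', h1, h2, rfl⟩
      · push Not at ha'
        -- Level `j + 3` is above the level of the surviving pebble, hence compares with it exactly
        -- as `a'` does, on either side.
        refine Or.inr (M.exists_answers (l := j + 3) (by omega) (by omega) (by omega) M.iso
          ⟨i, rfl, rfl⟩ (fun i' hi' => ha' i' (by omega)) (ha' i (by omega)) ?_ ?_ ?_)
        · exact M.not_adj_x (j := j + 2) (by omega) (by omega) fun i' hi' => ha' i' (by omega)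
        · intro i' hi' h
          rw [M.symm.injective h] at hi'
          omega
        · refine ⟨True, fun i' hi' _ => M.lt_iff_lt (fun i'' h => ha' _ (by omega)) ?_⟩
          intro i'' h h'
          rw [M.symm.injective h'] at h
          omega
  · refine ⟨fun a' b' => ((a = a' ∨ (gaifmanGraph L A).Adj a a') ∧ p a' b') ∨
      ∃ i, lev i ≤ j + 1 ∧ x i = a' ∧ y i = b', ?_, ?_, ?_⟩
    -- The two clauses of `m` never share a value: `b` is outside the levels up to `j + 2`, so
    -- neither `b` nor a neighbour of it has level at most `j + 1`.
    · have key : ∀ a' i, lev i ≤ j + 1 → (a = a' ∨ (gaifmanGraph L A).Adj a a') →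
          ¬ p a' (y i) := by
        rintro a' i hi (rfl | h) h'
        · exact hb i (by omega) ((hp.1.1 _ _ _ _ hab h').1 rfl).symm
        · have hadj := hp.1.adj hab h' (fun c hc => hpA c ((Near.of_adj hc).mono (by omega))) h
          exact M.symm.not_adj_x (j := j + 1) hi (by omega) hb hadj.symm
      rintro a₁ a₂ b' (⟨h1, h1'⟩ | ⟨i₁, h1, rfl, rfl⟩) (⟨h2, h2'⟩ | ⟨i₂, h2, rfl, h2'⟩)
      · exact (hp.1.1 _ _ _ _ h1' h2').2 rfl
      · subst h2'
        exact absurd h1' (key _ _ h2 h1)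
      · exact absurd h2' (key _ _ h1 h2)
      · rw [M.symm.injective h2']
    · rintro a' b' (⟨h1, h1'⟩ | ⟨i₁, h1, rfl, rfl⟩)
      · refine ⟨?_, pair hp hab h1'⟩
        obtain rfl | h1 := h1
        · obtain rfl := (hp.1.1 _ _ _ _ hab h1').1 rfl
          exact M.good_of_succ hj (Or.inr ⟨ha, hb, p, hab, hp, hpA, hpB⟩)
        · have hadj := hp.1.adj hab h1' (fun c hc => hpA c ((Near.of_adj hc).mono (by omega))) h1
          refine Or.inr ⟨?_, ?_, p, h1', hp, fun c hc => hpA c ⟨a', Or.inr h1, hc⟩,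
            fun c hc => hpB c ⟨b', Or.inr hadj, hc⟩⟩
          · rintro i hi rfl
            exact M.not_adj_x (j := j + 1) hi (by omega) ha h1.symm
          · rintro i hi rfl
            exact M.symm.not_adj_x (j := j + 1) hi (by omega) hb hadj.symm
      · refine ⟨Or.inl ⟨i₁, h1, rfl, rfl⟩, ?_⟩
        have hlt := M.lt_iff_lt (i := i₁) (fun i' h => ha i' (by omega))
          (fun i' h => hb i' (by omega))
        exact isOrderedPartialIso_pairRel hp M.iso hab ⟨i₁, rfl, rfl⟩ (ha i₁ (by omega)).symm
          (hb i₁ (by omega)).symm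
          (fun h => M.not_adj_x (j := j + 1) h1 (by omega) ha h.symm)
          (fun h => M.symm.not_adj_x (j := j + 1) h1 (by omega) hb h.symm) hlt.2 hlt.1
    · intro a'
      by_cases h1 : a = a' ∨ (gaifmanGraph L A).Adj a a'
      · obtain ⟨b', hb'⟩ : ∃ b', p a' b' := by
          obtain rfl | h1 := h1
          · exact ⟨b, hab⟩
          · exact hpA a' ((Near.of_adj h1).mono (by omega))
        exact Or.inl ⟨b', Or.inl ⟨h1, hb'⟩⟩
      by_cases ha' : ∃ i, lev i ≤ j + 1 ∧ x i = a'
      · obtain ⟨i', h1, h2⟩ := ha'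
        exact Or.inl ⟨y i', Or.inr ⟨i', h1, h2, rfl⟩⟩
      push Not at ha' h1
      refine Or.inr (M.exists_answers (l := j + 2) (by omega) (by omega) (by omega) hp
          hab ha' h1.1 h1.2 (fun i hi => hb i (by omega)) ?_)
      -- Since `b` is outside the levels up to `j + 2`, it lies between the left and the right
      -- copies of level `j + 2`; the side is chosen to match the order of `a` and `a'`.
      rcases trichotomous_of r a a' with h | h | h
      · refine ⟨False, fun i hi hl => ?_⟩
        have := M.right_y i b (by simpa using hl) fun i' h => hb i' (by omega)
        exact ⟨iff_of_true h this, iff_of_false (asymm_of r h) (asymm_of s this)⟩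
      · exact absurd h h1.1
      · refine ⟨True, fun i hi hl => ?_⟩
        have := M.left_y i b (by simpa using hl) fun i' h => hb i' (by omega)
        exact ⟨iff_of_false (asymm_of r h) (asymm_of s this), iff_of_true h this⟩

/-- The winning condition for both pebbles when `j` rounds remain. -/
def Position (L : FirstOrder.Language.{u, v}) {A B : Type w} [L.Structure A] [L.Structure B]
    (r : A → A → Prop) (s : B → B → Prop) {ι : Type w} (x : ι → A) (y : ι → B)
    (lev : ι → ℕ) (j : ℕ) (v : Fin 2 → A) (w : Fin 2 → B) : Prop :=
  (∀ k, Good L r s x y lev j (v k) (w k)) ∧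
    IsOrderedPartialIso L r s fun a b => ∃ k, v k = a ∧ w k = b

theorem position_symm {j : ℕ} {v : Fin 2 → A} {w : Fin 2 → B}
    (h : Position L r s x y lev j v w) : Position L s r y x lev j w v :=
  ⟨fun k => good_symm (h.1 k), h.2.flip.mono fun _ _ ⟨k, h1, h2⟩ => ⟨k, h2, h1⟩⟩

theorem position_update (M : Matching L r s K N d x y lev left) {j : ℕ} (hj : j + 1 ≤ K)
    {v : Fin 2 → A} {w : Fin 2 → B} {k k' : Fin 2} (hk : k' ≠ k)
    (h : Good L r s x y lev (j + 1) (v k') (w k')) {a : A} {b : B}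
    (hg : Good L r s x y lev j a b)
    (hp : IsOrderedPartialIso L r s (pairRel (v k') (w k') a b)) :
    Position L r s x y lev j (Function.update v k a) (Function.update w k b) := by
  have hcases : ∀ l : Fin 2, l = k ∨ l = k' := by omega
  refine ⟨fun l => ?_, hp.mono ?_⟩
  · obtain rfl | rfl := hcases l
    · simpa using hg
    · rw [Function.update_of_ne hk, Function.update_of_ne hk]
      exact M.good_of_succ hj h
  · rintro _ _ ⟨l, rfl, rfl⟩
    obtain rfl | rfl := hcases l
    · right; simp
    · left; simp [Function.update_of_ne hk]

/-- Constants have level `0`. A pebble pair that is not indexed avoids levels `0` and `1`, so its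
members are not adjacent to constants and no related tuple contains both. -/
theorem isOrderedPartialIso_constRel (M : Matching L r s K N d x y lev left) {j : ℕ}
    {v : Fin 2 → A} {w : Fin 2 → B} (h : Position L r s x y lev j v w) :
    IsOrderedPartialIso L r s
      fun a b => (∃ k, v k = a ∧ w k = b) ∨ constRel L A B a b := by
  have := M.order_x
  have := M.order_y
  have hcon : ∀ a b, constRel L A B a b → ∃ i, lev i = 0 ∧ x i = a ∧ y i = b := by
    rintro _ _ ⟨c, rfl, rfl⟩
    exact M.const c
  have hout : ∀ k, (∃ i, x i = v k ∧ y i = w k) ∨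
      ((∀ i, lev i ≤ j + 1 → x i ≠ v k) ∧ ∀ i, lev i ≤ j + 1 → y i ≠ w k) := fun k =>
    (h.1 k).imp (fun ⟨i, _, h⟩ => ⟨i, h⟩) fun h => ⟨h.1, h.2.1⟩
  have hmix : ∀ k a b, constRel L A B a b → (v k = a ↔ w k = b) ∧ (r (v k) a ↔ s (w k) b) ∧
      (r a (v k) ↔ s b (w k)) := by
    intro k a b hab
    obtain ⟨i, hi, rfl, rfl⟩ := hcon a b hab
    obtain h' | ⟨h1, h2⟩ := hout k
    · exact ⟨M.iso.1.1 _ _ _ _ h' ⟨i, rfl, rfl⟩, M.iso.2 _ _ _ _ h' ⟨i, rfl, rfl⟩,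
        M.iso.2 _ _ _ _ ⟨i, rfl, rfl⟩ h'⟩
    · have := M.lt_iff_lt (i := i) (fun i' h => h1 i' (by omega)) fun i' h => h2 i' (by omega)
      exact ⟨iff_of_false (h1 i (by omega)).symm (h2 i (by omega)).symm, this.2, this.1⟩
  have hcc : ∀ a b, constRel L A B a b → ∃ i, x i = a ∧ y i = b := fun a b hab =>
    let ⟨i, _, h⟩ := hcon a b hab; ⟨i, h⟩
  refine ⟨⟨?_, ?_⟩, ?_⟩
  · rintro _ _ _ _ (⟨k, rfl, rfl⟩ | hab) (⟨k', rfl, rfl⟩ | hab')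
    · exact h.2.1.1 _ _ _ _ ⟨k, rfl, rfl⟩ ⟨k', rfl, rfl⟩
    · exact (hmix k _ _ hab').1
    · rw [eq_comm, (hmix k' _ _ hab).1, eq_comm]
    · exact M.iso.1.1 _ _ _ _ (hcc _ _ hab) (hcc _ _ hab')
  · intro n R t t' ht
    by_cases hall : ∀ i, ∃ i', x i' = t i ∧ y i' = t' i
    · exact M.iso.1.2 n R t t' hall
    by_cases hvar : ∀ i, ∃ k, v k = t i ∧ w k = t' i
    · exact h.2.1.2 n R t t' hvar
    push Not at hall
    rw [not_forall] at hvar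
    obtain ⟨i₁, h₁⟩ := hall
    obtain ⟨i₂, h₂⟩ := hvar
    obtain ⟨e, he, he1, he2⟩ := hcon _ _ ((ht i₂).resolve_left h₂)
    have : ∀ a b, constRel L A B a b → ¬ (t i₁ = a ∧ t' i₁ = b) := by
      rintro a b hab ⟨rfl, rfl⟩
      obtain ⟨e, h1, h2⟩ := hcc _ _ hab
      exact h₁ e h1 h2
    obtain ⟨k, hk1, hk2⟩ := (ht i₁).resolve_right fun h => this _ _ h ⟨rfl, rfl⟩
    obtain ⟨h3, h4⟩ := (hout k).resolve_left fun ⟨e, h1, h2⟩ =>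
      h₁ e (h1.trans hk1) (h2.trans hk2)
    rw [hk1] at h3
    rw [hk2] at h4
    refine iff_of_false (fun hR => ?_) fun hR => ?_
    · have hne : t i₂ ≠ t i₁ := he1 ▸ h3 e (by omega)
      have hadj := adj_of_relMap hR hne
      rw [← he1] at hadj
      exact M.not_adj_x (j := 0) (by omega) (by omega) (fun i hi => h3 i (by omega)) hadj
    · have hne : t' i₂ ≠ t' i₁ := he2 ▸ h4 e (by omega)
      have hadj := adj_of_relMap hR hne
      rw [← he2] at hadj
      exact M.symm.not_adj_x (j := 0) (by omega) (by omega) (fun i hi => h4 i (by omega)) hadj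
  · rintro _ _ _ _ (⟨k, rfl, rfl⟩ | hab) (⟨k', rfl, rfl⟩ | hab')
    · exact h.2.2 _ _ _ _ ⟨k, rfl, rfl⟩ ⟨k', rfl, rfl⟩
    · exact (hmix k _ _ hab').2.1
    · exact (hmix k' _ _ hab).2.2
    · exact M.iso.2 _ _ _ _ (hcc _ _ hab) (hcc _ _ hab')

end Matching

end Game

/-! ### From the game to equivalence of `C²`-formulas. -/

/-- The quantifier rank. -/
def CtwoFormula.rank {L : FirstOrder.Language.{u, v}} : CtwoFormula L → ℕ
  | falsum => 0
  | equal _ _ => 0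
  | rel _ _ => 0
  | imp φ ψ => max φ.rank ψ.rank
  | all _ φ => φ.rank + 1
  | existsGE _ _ φ => φ.rank + 1

/-- The largest number occurring in a counting quantifier. -/
def CtwoFormula.maxCount {L : FirstOrder.Language.{u, v}} : CtwoFormula L → ℕ
  | falsum => 0
  | equal _ _ => 0
  | rel _ _ => 0
  | imp φ ψ => max φ.maxCount ψ.maxCount
  | all _ φ => φ.maxCount
  | existsGE i _ φ => max i φ.maxCount

section Realize

variable {L : FirstOrder.Language.{u, v}} {A B : Type w} [L.Structure A] [L.Structure B]

theorem term_eq (hconst : ∀ n : ℕ, IsEmpty (L.Functions (n + 1))) (t : (withLt L).Term (Fin 2)) :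
    (∃ k, t = Term.var k) ∨ ∃ c : L.Constants, t = Term.func (l := 0) (Sum.inl c) default := by
  cases t with
  | var k => exact Or.inl ⟨k, rfl⟩
  | @func n f ts =>
    obtain f | f := f
    · cases n with
      | zero => exact Or.inr ⟨f, by rw [Subsingleton.elim ts default]⟩
      | succ n => exact (hconst n).elim f
    · exact nomatch f

/-- The value of a term in an ordered structure. -/
def termValue (r : A → A → Prop) (t : (withLt L).Term (Fin 2)) (v : Fin 2 → A) : A :=
  @Term.realize (withLt L) A (orderExpansion L A r) _ v t

theorem termValue_rel (hconst : ∀ n : ℕ, IsEmpty (L.Functions (n + 1)))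
    (r : A → A → Prop) (s : B → B → Prop) (t : (withLt L).Term (Fin 2)) (v : Fin 2 → A)
    (w : Fin 2 → B) : (∃ k, v k = termValue r t v ∧ w k = termValue s t w) ∨
      constRel L A B (termValue r t v) (termValue s t w) := by
  obtain ⟨k, rfl⟩ | ⟨c, rfl⟩ := term_eq hconst t
  · exact Or.inl ⟨k, rfl, rfl⟩
  · exact Or.inr ⟨c, funMap_eq_coe_constants (L := L), funMap_eq_coe_constants (L := L)⟩

/-- Truth in an ordered structure. -/
def RealizeOrdered (r : A → A → Prop) (φ : CtwoFormula (withLt L)) (v : Fin 2 → A) : Prop :=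
  @CtwoFormula.Realize (withLt L) A (orderExpansion L A r) φ v

variable {r : A → A → Prop} {s : B → B → Prop} {K N d : ℕ} {ι : Type w} {x : ι → A} {y : ι → B}
  {lev : ι → ℕ} {left : ι → Prop}

namespace Matching

theorem exists_update (M : Matching L r s K N d x y lev left) [Finite B] {j : ℕ}
    (hj : j + 1 ≤ K) {v : Fin 2 → A} {w : Fin 2 → B} (h : Position L r s x y lev (j + 1) v w)
    (k : Fin 2) : ∃ m : A → B → Prop, (∀ a₁ a₂ b', m a₁ b' → m a₂ b' → a₁ = a₂) ∧
      (∀ a' b', m a' b' →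
        Position L r s x y lev j (Function.update v k a') (Function.update w k b')) ∧
      ∀ a', (∃ b', m a' b') ∨ ∃ F : Finset B, N ≤ F.card ∧ ∀ b' ∈ F,
        Position L r s x y lev j (Function.update v k a') (Function.update w k b') := by
  obtain ⟨k', hk⟩ : ∃ k' : Fin 2, k' ≠ k := ⟨1 - k, by omega⟩
  obtain ⟨m, h1, h2, h3⟩ := M.exists_move hj (h.1 k')
  refine ⟨m, h1, fun a' b' hm => ?_, fun a' => (h3 a').imp_right ?_⟩
  · exact M.position_update hj hk (h.1 k') (h2 a' b' hm).1 (h2 a' b' hm).2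
  · rintro ⟨F, hF, hF'⟩
    exact ⟨F, hF, fun b' hb' => M.position_update hj hk (h.1 k') (hF' b' hb').1 (hF' b' hb').2⟩

theorem exists_response (M : Matching L r s K N d x y lev left) [Finite B] (hN : 1 ≤ N) {j : ℕ}
    (hj : j + 1 ≤ K) {v : Fin 2 → A} {w : Fin 2 → B} (h : Position L r s x y lev (j + 1) v w)
    (k : Fin 2) (a : A) :
    ∃ b, Position L r s x y lev j (Function.update v k a) (Function.update w k b) := by
  obtain ⟨m, -, h2, h3⟩ := M.exists_update hj h k
  obtain ⟨b, hb⟩ | ⟨F, hF, hF'⟩ := h3 a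
  · exact ⟨b, h2 a b hb⟩
  · obtain ⟨b, hb⟩ := Finset.card_pos.1 (hN.trans hF)
    exact ⟨b, hF' b hb⟩

/-- If all witnesses have forced answers, injectivity preserves their number. Otherwise one witness
alone has `N ≥ i` answers, each of which inherits its truth. -/
theorem exists_card (M : Matching L r s K N d x y lev left) [Finite B] {j i : ℕ} (hi : i ≤ N)
    (hj : j + 1 ≤ K) {v : Fin 2 → A} {w : Fin 2 → B} (h : Position L r s x y lev (j + 1) v w)
    (k : Fin 2) (S : Set A) (T : Set B)
    (hST : ∀ a b, Position L r s x y lev j (Function.update v k a) (Function.update w k b) →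
      a ∈ S → b ∈ T)
    (hS : ∃ F : Finset A, F.card = i ∧ ∀ a ∈ F, a ∈ S) :
    ∃ F : Finset B, F.card = i ∧ ∀ b ∈ F, b ∈ T := by
  classical
  obtain ⟨m, h1, h2, h3⟩ := M.exists_update hj h k
  obtain ⟨F, hF, hFS⟩ := hS
  by_cases hm : ∀ a ∈ F, ∃ b, m a b
  · choose f hf using fun a : F => hm a a.2
    have hinj : Function.Injective f := fun a a' e =>
      Subtype.ext (h1 a a' (f a) (hf a) (e ▸ hf a'))
    refine ⟨F.attach.image f, by rw [Finset.card_image_of_injective _ hinj, Finset.card_attach, hF],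
      fun b hb => ?_⟩
    obtain ⟨a, -, rfl⟩ := Finset.mem_image.1 hb
    exact hST a (f a) (h2 _ _ (hf a)) (hFS a a.2)
  · rw [not_forall] at hm
    obtain ⟨a, ha⟩ := hm
    rw [Classical.not_imp] at ha
    obtain ⟨F', hF', hF''⟩ := (h3 a).resolve_left ha.2
    obtain ⟨G, hG, hG'⟩ := Finset.exists_subset_card_eq (hi.trans hF')
    exact ⟨G, hG', fun b hb => hST a b (hF'' b (hG hb)) (hFS a ha.1)⟩

theorem realize_iff (hconst : ∀ n : ℕ, IsEmpty (L.Functions (n + 1)))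
    (M : Matching L r s K N d x y lev left) [Finite A] [Finite B] (hN : 1 ≤ N)
    (φ : CtwoFormula (withLt L)) {j : ℕ} (hj : j ≤ K) (hφ : φ.rank ≤ j) (hφN : φ.maxCount ≤ N)
    {v : Fin 2 → A} {w : Fin 2 → B} (h : Position L r s x y lev j v w) :
    RealizeOrdered r φ v ↔ RealizeOrdered s φ w := by
  induction φ generalizing j v w with
  | falsum => exact Iff.rfl
  | equal t₁ t₂ =>
    exact (M.isOrderedPartialIso_constRel h).1.1 _ _ _ _ (termValue_rel hconst r s t₁ v w)
      (termValue_rel hconst r s t₂ v w)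
  | @rel n R ts =>
    obtain R | R := R
    · exact (M.isOrderedPartialIso_constRel h).1.2 n R _ _
        fun i => termValue_rel hconst r s (ts i) v w
    · cases R
      exact (M.isOrderedPartialIso_constRel h).2 _ _ _ _ (termValue_rel hconst r s (ts 0) v w)
        (termValue_rel hconst r s (ts 1) v w)
  | imp φ ψ ih₁ ih₂ =>
    rw [CtwoFormula.rank, max_le_iff] at hφ
    rw [CtwoFormula.maxCount, max_le_iff] at hφN
    exact imp_congr (ih₁ hj hφ.1 hφN.1 h) (ih₂ hj hφ.2 hφN.2 h)
  | all k φ ih =>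
    rw [CtwoFormula.rank] at hφ
    obtain ⟨j, rfl⟩ : ∃ i, j = i + 1 := ⟨j - 1, by omega⟩
    constructor
    · intro hv b
      obtain ⟨a, ha⟩ := M.symm.exists_response hN hj (position_symm h) k b
      exact (ih (by omega) (by omega) hφN (position_symm ha)).1 (hv a)
    · intro hw a
      obtain ⟨b, hb⟩ := M.exists_response hN hj h k a
      exact (ih (by omega) (by omega) hφN hb).2 (hw b)
  | existsGE i k φ ih =>
    rw [CtwoFormula.rank] at hφ
    rw [CtwoFormula.maxCount, max_le_iff] at hφN
    obtain ⟨j, rfl⟩ : ∃ i, j = i + 1 := ⟨j - 1, by omega⟩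
    constructor
    · exact M.exists_card hφN.1 hj h k {a | RealizeOrdered r φ (Function.update v k a)}
        {b | RealizeOrdered s φ (Function.update w k b)}
        fun a b hab => (ih (by omega) (by omega) hφN.2 hab).1
    · exact M.symm.exists_card hφN.1 hj (position_symm h) k
        {b | RealizeOrdered s φ (Function.update w k b)}
        {a | RealizeOrdered r φ (Function.update v k a)}
        fun b a hab => (ih (by omega) (by omega) hφN.2 (position_symm hab)).2

theorem exists_position (M : Matching L r s K N d x y lev left) (hN : 1 ≤ N) [Nonempty A] :
    ∃ v w, Position L r s x y lev K v w := by
  obtain ⟨a⟩ := ‹Nonempty A›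
  obtain ⟨b, hb⟩ : ∃ b, Good L r s x y lev K a b := by
    by_cases ha : ∃ i, lev i ≤ K + 1 ∧ x i = a
    · obtain ⟨i, h1, h2⟩ := ha
      exact ⟨y i, Or.inl ⟨i, h1, h2, rfl⟩⟩
    · push Not at ha
      obtain ⟨F, hF, hF'⟩ := M.rich_x a (fun i hi => ha i (by omega)) (K + 2) (by omega) True
      obtain ⟨i, hi⟩ := Finset.card_pos.1 (show 0 < F.card by omega)
      obtain ⟨h1, -, h2⟩ := hF' i hi
      refine ⟨y i, Or.inr ⟨ha, fun i' hi' h => ?_, h2⟩⟩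
      rw [M.symm.injective h] at hi'
      omega
  obtain ⟨p, hp, hab⟩ := M.exists_iso_of_good hb
  refine ⟨fun _ => a, fun _ => b, fun _ => hb, hp.mono ?_⟩
  rintro _ _ ⟨_, rfl, rfl⟩
  exact hab

/-- Prefixing two universal quantifiers makes the assignment irrelevant, so any initial position
serves; this costs two rounds. -/
theorem realize_forall_iff (hconst : ∀ n : ℕ, IsEmpty (L.Functions (n + 1)))
    (φ : CtwoFormula (withLt L)) (hK : φ.rank + 2 ≤ K) (hN : 1 ≤ N) (hφN : φ.maxCount ≤ N)
    (M : Matching L r s K N d x y lev left) [Finite A] [Finite B] [Nonempty A] :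
    (∀ v, RealizeOrdered r φ v) ↔ ∀ w, RealizeOrdered s φ w := by
  have key : ∀ {C : Type w} [L.Structure C] (q : C → C → Prop) (v : Fin 2 → C),
      (∀ v, RealizeOrdered q φ v) ↔ RealizeOrdered q (.all 0 (.all 1 φ)) v := by
    intro C _ q v
    refine ⟨fun h a b => h _, fun h v' => ?_⟩
    have : Function.update (Function.update v 0 (v' 0)) 1 (v' 1) = v' := by
      ext k
      fin_cases k <;> simp
    exact this ▸ h (v' 0) (v' 1)
  obtain ⟨v, w, h⟩ := M.exists_position hN
  rw [key r v, key s w]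
  exact M.realize_iff hconst hN (.all 0 (.all 1 φ)) le_rfl hK hφN h

end Matching

end Realize

/-! ### Rare colours and scattered representatives of the others. -/

section Selection

/-- Greedy choice: the balls around `R` and the centres already chosen are too small to cover the
next `U i`. -/
theorem exists_scattered {V I : Type*} [Finite V] [Finite I] (near : V → V → Prop)
    (hsymm : ∀ a b, near a b → near b a) {M : ℕ} (hM : ∀ a, {b | near a b}.ncard ≤ M) (R : Set V)
    (U : I → Set V) (hU : ∀ i, (R.ncard + Nat.card I) * M < (U i).ncard) :
    ∃ c : I → V, (∀ i, c i ∈ U i) ∧ (∀ i, ∀ z ∈ R, ¬ near z (c i)) ∧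
      ∀ i j, i ≠ j → ¬ near (c i) (c j) := by
  classical
  have := Fintype.ofFinite I
  have hR : R.Finite := Set.toFinite R
  suffices ∀ s : Finset I, ∃ c : I → V, (∀ i ∈ s, c i ∈ U i) ∧
      (∀ i ∈ s, ∀ z ∈ R, ¬ near z (c i)) ∧ ∀ i ∈ s, ∀ j ∈ s, i ≠ j → ¬ near (c i) (c j) by
    simpa using this Finset.univ
  intro s
  induction s using Finset.induction_on with
  | empty =>
    have : ∀ i, ∃ a, a ∈ U i := fun i =>
      Set.nonempty_of_ncard_ne_zero (by have := hU i; omega)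
    choose c hc using this
    exact ⟨c, by simp, by simp, by simp⟩
  | insert i s hi ih =>
    obtain ⟨c, h1, h2, h3⟩ := ih
    set Z : Finset V := hR.toFinset ∪ s.image c with hZ
    have hcard : (⋃ z ∈ Z, {b | near z b}).ncard < (U i).ncard := by
      refine lt_of_le_of_lt ?_ (hU i)
      refine (Finset.set_ncard_biUnion_le _ _).trans ?_
      refine (Finset.sum_le_card_nsmul _ _ _ fun z _ => hM z).trans ?_
      rw [smul_eq_mul]
      refine Nat.mul_le_mul_right _ ((Finset.card_union_le _ _).trans ?_)
      refine Nat.add_le_add (Set.ncard_eq_toFinset_card _ hR).ge ?_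
      rw [Nat.card_eq_fintype_card]
      exact Finset.card_image_le.trans (Finset.card_le_univ s)
    obtain ⟨a, ha, hna⟩ := Set.exists_mem_notMem_of_ncard_lt_ncard hcard
    simp only [Set.mem_iUnion, not_exists] at hna
    have hna' : ∀ z ∈ Z, ¬ near z a := hna
    have hs : ∀ j ∈ s, Function.update c i a j = c j := fun j hj => by
      rw [Function.update_of_ne]
      rintro rfl
      exact hi hj
    have hca : ∀ j ∈ s, ¬ near (c j) a := fun j hj =>
      hna' _ (Finset.mem_union_right _ (Finset.mem_image_of_mem c hj))
    refine ⟨Function.update c i a, ?_, ?_, ?_⟩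
    · intro j hj
      obtain rfl | hj' := Finset.mem_insert.1 hj
      · simpa using ha
      · rw [hs j hj']; exact h1 j hj'
    · intro j hj z hz
      obtain rfl | hj' := Finset.mem_insert.1 hj
      · rw [Function.update_self]
        exact hna' z (Finset.mem_union_left _ (hR.mem_toFinset.2 hz))
      · rw [hs j hj']; exact h2 j hj' z hz
    · intro j hj k hk hjk
      obtain rfl | hj' := Finset.mem_insert.1 hj <;> obtain rfl | hk' := Finset.mem_insert.1 hk
      · exact absurd rfl hjk
      · rw [Function.update_self, hs k hk']
        exact fun h => hca k hk' (hsymm _ _ h)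
      · rw [Function.update_self, hs j hj']
        exact hca j hj'
      · rw [hs j hj', hs k hk']; exact h3 j hj' k hk' hjk

/-- The growth of the number of vertices of rare colours with the number of rare colours. -/
def rareBound (n M q : ℕ) : ℕ → ℕ
  | 0 => n
  | s + 1 => rareBound n M q s + (rareBound n M q s + q) * M

theorem rareBound_mono (n M q : ℕ) : Monotone (rareBound n M q) :=
  monotone_nat_of_le_succ fun _ => Nat.le_add_right _ _

/-- Few vertices have a rare colour, and the other colours have many scattered vertices. -/
theorem exists_rare {V Col J : Type*} [Finite V] [Finite Col] [Finite J] (near : V → V → Prop)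
    (hsymm : ∀ a b, near a b → near b a) {M n : ℕ} (hM : ∀ a, {b | near a b}.ncard ≤ M)
    (col : V → Col) (base : Set V) (hbase : base.ncard ≤ n) :
    ∃ S : Set Col,
      (base ∪ col ⁻¹' S).ncard ≤ rareBound n M (Nat.card Col * Nat.card J) (Nat.card Col) ∧
      ∃ c : {τ // τ ∉ S} × J → V, (∀ k, col (c k) = k.1) ∧
        (∀ k, ∀ z ∈ base ∪ col ⁻¹' S, ¬ near z (c k)) ∧ ∀ k k', k ≠ k' → ¬ near (c k) (c k') := by
  set g := rareBound n M (Nat.card Col * Nat.card J) with hg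
  -- For a maximal such `S`, adding any further colour breaks the bound, so that colour has enough
  -- vertices for the greedy choice.
  obtain ⟨S, hS, hmax⟩ := Set.exists_max_image
    {S : Set Col | (base ∪ col ⁻¹' S).ncard ≤ g S.ncard} Set.ncard (Set.toFinite _)
    ⟨∅, by simpa [hg, rareBound] using hbase⟩
  have hS : (base ∪ col ⁻¹' S).ncard ≤ g S.ncard := hS
  refine ⟨S, hS.trans (rareBound_mono _ _ _ (Set.ncard_le_card S)), ?_⟩
  have hI : Nat.card ({τ // τ ∉ S} × J) ≤ Nat.card Col * Nat.card J := by
    rw [Nat.card_prod]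
    exact Nat.mul_le_mul_right _ (Finite.card_subtype_le _)
  obtain ⟨c, h1, h2, h3⟩ := exists_scattered near hsymm hM (base ∪ col ⁻¹' S)
    (fun k : {τ // τ ∉ S} × J => col ⁻¹' {k.1.1}) (by
      rintro ⟨⟨τ, hτ⟩, -⟩
      have hins : (insert τ S).ncard = S.ncard + 1 := Set.ncard_insert_of_notMem hτ
      have hbig : g (S.ncard + 1) < (base ∪ col ⁻¹' (insert τ S)).ncard := by
        by_contra h
        have := hmax (insert τ S) (by
          change _ ≤ g _
          rw [hins]
          exact not_lt.1 h)
        omega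
      have hle : (base ∪ col ⁻¹' (insert τ S)).ncard ≤
          (base ∪ col ⁻¹' S).ncard + (col ⁻¹' {τ}).ncard := by
        refine (Set.ncard_le_ncard ?_ (Set.toFinite _)).trans (Set.ncard_union_le _ _)
        rintro a (h | h | h)
        · exact Or.inl (Or.inl h)
        · exact Or.inr h
        · exact Or.inl (Or.inr h)
      have hstep : g (S.ncard + 1) = g S.ncard + (g S.ncard + Nat.card Col * Nat.card J) * M := rfl
      have := Nat.mul_le_mul_right M (Nat.add_le_add hS hI)
      change _ < (col ⁻¹' {τ}).ncard
      omega)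
  exact ⟨c, h1, h2, h3⟩

end Selection

/-! ### The bounded part `X` and its levels. -/

section Layout

variable {L : FirstOrder.Language.{u, v}} {A B : Type w} [L.Structure A] [L.Structure B]

/-- The tuple `e'` enumerates the ball of radius `K` around `z` in the way in which `e` enumerates
the one around `a`. -/
def Enumerates (L : FirstOrder.Language.{u, v}) {A B : Type w} [L.Structure A] [L.Structure B]
    (K : ℕ) {m : ℕ} (e : Fin m → A) (a : A) (z : B) (e' : Fin m → B) : Prop :=
  IsPartialIso L (fun x y => ∃ i, e i = x ∧ e' i = y) ∧ (∃ i, e i = a ∧ e' i = z) ∧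
    ∀ b, Near L K z b ↔ ∃ i, e' i = b

/-- `m` rounds copy the ball; the `k + 1` left over preserve adjacency in both directions, so the
image is exactly the ball around `z`. -/
theorem BackForth.exists_enumerates [Nonempty A] [Nonempty B] {K m k : ℕ}
    (hk : ∀ n, Nonempty (L.Relations n) → n ≤ k) {e : Fin m → A} {a : A} {z : B}
    (he : ∀ b, Near L K a b ↔ ∃ i, e i = b) {p : A → B → Prop}
    (h : BackForth L (m + (k + 1)) p) (haz : p a z) : ∃ e', Enumerates L K e a z e' := by
  classical
  obtain ⟨f, hf⟩ := h.exists_fun (Finset.univ.image e)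
    (Finset.card_image_le.trans (by simp))
  set q : A → B → Prop := fun a b => p a b ∨ (a ∈ Finset.univ.image e ∧ b = f a) with hq
  have hmem : ∀ i, q (e i) (f (e i)) := fun i => Or.inr ⟨by simp, rfl⟩
  have hfun : ∀ i b, q (e i) b → f (e i) = b := fun i b hb =>
    (hf.isPartialIso.1 _ _ _ _ (hmem i) hb).1 rfl
  have hcov : ∀ c, Near L K a c → ∃ c', q c c' := by
    intro c hc
    obtain ⟨i, rfl⟩ := (he c).1 hc
    exact ⟨_, hmem i⟩
  have hback : ∀ b, Near L K z b → ∃ i, f (e i) = b ∧ q (e i) b := by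
    intro b hb
    obtain ⟨c, hc, hc'⟩ := hf.exists_near hk le_rfl (Or.inl haz) hcov hb
    obtain ⟨i, rfl⟩ := (he c).1 hc'
    exact ⟨i, hfun i b hc, hc⟩
  refine ⟨f ∘ e, hf.isPartialIso.mono ?_, ?_, fun b => ⟨fun hb => ?_, ?_⟩⟩
  · rintro _ _ ⟨i, rfl, rfl⟩
    exact hmem i
  · obtain ⟨i, hi⟩ := (he a).1 (Near.refl K a)
    exact ⟨i, hi, hfun i z (by rw [hi]; exact Or.inl haz)⟩
  · obtain ⟨i, hi, -⟩ := hback b hb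
    exact ⟨i, hi⟩
  · rintro ⟨i, rfl⟩
    obtain ⟨b, hb, hb'⟩ := hf.flip.exists_near hk le_rfl (a := z) (b := a) (Or.inl haz)
      (fun c hc => let ⟨i, _, h⟩ := hback c hc; ⟨_, h⟩) ((he _).2 ⟨i, rfl⟩)
    have : f (e i) = b := hfun i b hb
    rw [Function.comp_apply, this]
    exact hb'

/-- The elements within distance `K + l` of `R`, or within distance `K + l - f k` of a centre
`c k` of base level `f k ≤ l`. -/
def InLayer (L : FirstOrder.Language.{u, v}) {A : Type w} [L.Structure A] (K : ℕ) (R : Set A)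
    {I : Type*} (f : I → ℕ) (c : I → A) (l : ℕ) (a : A) : Prop :=
  (∃ z ∈ R, Near L (K + l) z a) ∨ ∃ k, f k ≤ l ∧ Near L (K + l - f k) (c k) a

section InLayer

variable {K : ℕ} {R : Set A} {I : Type*} {f : I → ℕ} {c : I → A}

theorem InLayer.succ_of_adj {l : ℕ} {a a' : A} (h : InLayer L K R f c l a)
    (ha : (gaifmanGraph L A).Adj a a') : InLayer L K R f c (l + 1) a' := by
  obtain ⟨z, hz, h⟩ | ⟨k, hk, h⟩ := h
  · exact Or.inl ⟨z, hz, (h.trans (Near.of_adj ha)).mono (by omega)⟩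
  · exact Or.inr ⟨k, by omega, (h.trans (Near.of_adj ha)).mono (by omega)⟩

theorem InLayer.mono {l l' : ℕ} (hl : l ≤ l') {a : A} (h : InLayer L K R f c l a) :
    InLayer L K R f c l' a := by
  obtain ⟨z, hz, h⟩ | ⟨k, hk, h⟩ := h
  · exact Or.inl ⟨z, hz, h.mono (by omega)⟩
  · exact Or.inr ⟨k, by omega, h.mono (by omega)⟩

theorem inLayer_of_near {k : I} {a : A} (h : Near L K (c k) a) : InLayer L K R f c (f k) a :=
  Or.inr ⟨k, le_rfl, h.mono (by omega)⟩

theorem ncard_inLayer_le [Finite A] [Finite I] {d : ℕ}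
    (hd : ∀ a : A, ((gaifmanGraph L A).neighborSet a).ncard ≤ d) (l : ℕ) :
    {a | InLayer L K R f c l a}.ncard ≤ (R.ncard + Nat.card I) * (d + 1) ^ (K + l) := by
  classical
  have := Fintype.ofFinite I
  have hR : R.Finite := Set.toFinite R
  have hsub : {a | InLayer L K R f c l a} ⊆
      ⋃ z ∈ hR.toFinset ∪ Finset.univ.image c, {b | Near L (K + l) z b} := by
    intro a ha
    simp only [Set.mem_iUnion]
    obtain ⟨z, hz, h⟩ | ⟨k, -, h⟩ := ha
    · exact ⟨z, by simp [hz], h⟩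
    · exact ⟨c k, by simp, h.mono (by omega)⟩
  refine (Set.ncard_le_ncard hsub (Set.toFinite _)).trans ?_
  refine (Finset.set_ncard_biUnion_le _ _).trans ?_
  refine (Finset.sum_le_card_nsmul _ _ _ fun z _ => ncard_near_le hd _ z).trans ?_
  rw [smul_eq_mul]
  refine Nat.mul_le_mul_right _ ((Finset.card_union_le _ _).trans ?_)
  refine Nat.add_le_add (Set.ncard_eq_toFinset_card _ hR).ge ?_
  rw [Nat.card_eq_fintype_card]
  exact Finset.card_image_le.trans (Finset.card_univ (α := I)).le

/-- Scattering makes the level of every point of the `K`-ball around a centre equal to the base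
level of that centre: a smaller level would bring the centre close to `R` or to another centre. -/
theorem not_inLayer_of_near {l H : ℕ} (hR : ∀ k, ∀ z ∈ R, ¬ Near L (2 * (K + H)) z (c k))
    (hc : ∀ k k', k ≠ k' → ¬ Near L (2 * (K + H)) (c k) (c k')) {k : I} {a : A}
    (h : Near L K (c k) a) (hlk : l < f k) (hl : l ≤ H) : ¬ InLayer L K R f c l a := by
  rintro (⟨z, hz, h'⟩ | ⟨k', hk', h'⟩)
  · exact hR k z hz ((h'.trans h.symm).mono (by omega))
  · refine hc k' k ?_ ((h'.trans h.symm).mono (by omega))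
    rintro rfl
    omega

end InLayer

theorem exists_range_eq {s : Set A} (hs : s.Finite) (hne : s.Nonempty) {m : ℕ}
    (hm : s.ncard ≤ m) : ∃ e : Fin m → A, ∀ b, b ∈ s ↔ ∃ i, e i = b := by
  have := hs.to_subtype
  have := hne.to_subtype
  have := Fintype.ofFinite s
  have hcard : Fintype.card s ≤ Fintype.card (Fin m) := by
    rwa [Fintype.card_fin, ← Nat.card_eq_fintype_card, Nat.card_coe_set_eq]
  obtain ⟨g⟩ := Function.Embedding.nonempty_of_card_le hcard
  refine ⟨fun i => (Function.invFun g i : s), fun b => ⟨fun hb => ⟨g ⟨b, hb⟩, ?_⟩, ?_⟩⟩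
  · exact congrArg Subtype.val (Function.leftInverse_invFun g.injective ⟨b, hb⟩)
  · rintro ⟨i, rfl⟩
    exact (Function.invFun g i).2

/-- A bounded part `X` of `A` with levels, sides and local ranks that realizes all orders of the
balls of radius `K` around the elements outside of level `0`, on both sides of each level. -/
structure Layout (L : FirstOrder.Language.{u, v}) {A : Type w} [L.Structure A]
    (K N m n : ℕ) (X : Finset A) (lev : A → ℕ) (left : A → Prop) (rk : A → ℕ) : Prop where
  lev_le : ∀ a ∈ X, lev a ≤ 2 * K + 3
  const : ∀ c : L.Constants, (c : A) ∈ X ∧ lev c = 0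
  closed : ∀ a ∈ X, lev a < 2 * K + 3 → ∀ a', (gaifmanGraph L A).Adj a a' →
    a' ∈ X ∧ lev a' ≤ lev a + 1
  rich : ∀ a, (a ∈ X → lev a ≠ 0) → ∃ (a₀ : A) (e : Fin m → A),
    (∀ b, Near L K a₀ b ↔ ∃ i, e i = b) ∧ (∃ p, BackForth L n p ∧ p a₀ a) ∧
    ∀ ρ : Fin m → Fin m, (∀ i i', e i = e i' → ρ i = ρ i') → ∀ l ≤ K + 3, ∀ S : Prop,
      ∃ F : Finset A, N ≤ F.card ∧ ∀ z ∈ F, ∃ e' : Fin m → A, Enumerates L K e a₀ z e' ∧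
        ∀ i, e' i ∈ X ∧ lev (e' i) = l ∧ (left (e' i) ↔ S) ∧ rk (e' i) = ρ i

theorem exists_layout (hfin : Finite L.Symbols) (d K N k : ℕ)
    (hk : ∀ n, Nonempty (L.Relations n) → n ≤ k) (hN : 1 ≤ N) :
    ∃ n₀ : ℕ, ∀ (A : Type w) [L.Structure A] [Finite A] [Nonempty A],
      (∀ a : A, ((gaifmanGraph L A).neighborSet a).ncard ≤ d) →
      ∃ X lev left rk, X.card ≤ n₀ ∧
        Layout L (A := A) K N ((d + 1) ^ K) ((d + 1) ^ K + (k + 1)) X lev left rk := by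
  classical
  have : Finite L.Constants := Finite.of_injective
    (fun c => (Sum.inl ⟨0, c⟩ : L.Symbols)) (fun c c' h => by simpa using h)
  set m := (d + 1) ^ K with hm
  obtain ⟨S₁, hS₁, hback⟩ := exists_finite_backForth.{u, v, w} hfin (m + (k + 1)) 1
  have := hS₁.to_subtype
  set H := 2 * K + 3 with hH
  -- One centre per frequent colour and per choice of ball order, level, side (`true` is left) and
  -- copy number.
  let J := (Fin m → Fin m) × Fin (K + 4) × Bool × Fin N
  refine ⟨(rareBound (Nat.card L.Constants) ((d + 1) ^ (2 * (K + H)))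
    (Nat.card (Set S₁) * Nat.card J) (Nat.card (Set S₁)) + Nat.card (Set S₁) * Nat.card J) *
    (d + 1) ^ (K + H), fun A _ _ _ hd => ?_⟩
  let col : A → Set S₁ := fun a => {θ | θ.1.Realize default fun _ => a}
  have hcol : ∀ a b, col a = col b → ∃ p : A → A → Prop, BackForth L (m + (k + 1)) p ∧ p a b :=
    fun a b hab => ⟨_, hback A A (fun _ => a) (fun _ => b)
      (fun θ hθ => Set.ext_iff.1 hab ⟨θ, hθ⟩), Or.inr ⟨0, rfl, rfl⟩⟩
  obtain ⟨S, hRcard, c, hc1, hcR, hcc⟩ := exists_rare (J := J)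
    (Near L (A := A) (2 * (K + H))) (fun _ _ h => h.symm) (ncard_near_le hd _) col
    (Set.range fun c : L.Constants => (c : A)) (Finite.card_range_le _)
  set R := Set.range (fun c : L.Constants => (c : A)) ∪ col ⁻¹' S with hR
  let f : {τ // τ ∉ S} × J → ℕ := fun k => k.2.2.1
  have hf : ∀ k, f k ≤ H := fun k => by
    have := k.2.2.1.2
    change (k.2.2.1 : ℕ) ≤ H
    omega
  have hfinX : {a | InLayer L K R f c H a}.Finite := Set.toFinite _
  -- Outside every layer the infimum is that of the empty set, so `lev` is `0` there; level `0` is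
  -- therefore always read together with membership in `X`.
  let lev : A → ℕ := fun a => sInf {l | InLayer L K R f c l a}
  have hlev_le : ∀ {l a}, InLayer L K R f c l a → lev a ≤ l := fun h => Nat.sInf_le h
  have hlev : ∀ {l a}, InLayer L K R f c l a → InLayer L K R f c (lev a) a := fun {l a} h =>
    Nat.sInf_mem (s := {l | InLayer L K R f c l a}) ⟨l, h⟩
  have hmem : ∀ {a}, a ∈ hfinX.toFinset ↔ InLayer L K R f c H a := fun {a} => by simp
  -- One reference enumeration per colour, so that a rank function `ρ` refers to the same positions
  -- in all balls of that colour.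
  have hrep : ∀ τ : {τ // τ ∉ S}, ∃ (a₀ : A) (e : Fin m → A), col a₀ = τ ∧
      ∀ b, Near L K a₀ b ↔ ∃ i, e i = b := by
    intro τ
    have j : J := (id, 0, true, ⟨0, hN⟩)
    obtain ⟨e, he⟩ := exists_range_eq (s := {b | Near L K (c (τ, j)) b}) (Set.toFinite _)
      ⟨_, Near.refl _ _⟩ (ncard_near_le hd K _)
    exact ⟨c (τ, j), e, hc1 _, he⟩
  choose a₀ e ha₀ he using hrep
  have hcen : ∀ k, ∃ e', Enumerates L K (e k.1) (a₀ k.1) (c k) e' := by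
    intro k
    obtain ⟨p, hp, hp'⟩ := hcol (a₀ k.1) (c k) ((ha₀ _).trans (hc1 k).symm)
    exact hp.exists_enumerates hk (he k.1) hp'
  choose ec hec using hcen
  have hnear : ∀ k i, Near L K (c k) (ec k i) := fun k i => ((hec k).2.2 _).2 ⟨i, rfl⟩
  let rk : A → ℕ := fun a => if h : ∃ k i, ec k i = a then
    h.choose.2.1 h.choose_spec.choose else 0
  -- The balls of distinct centres are disjoint and `ρ` respects repetitions in `e`, so the choices
  -- made in `rk` do not matter.
  have hrk : ∀ k, (∀ i i', e k.1 i = e k.1 i' → k.2.1 i = k.2.1 i') → ∀ i,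
      rk (ec k i) = k.2.1 i := by
    intro k hρ i
    have h : ∃ k' i', ec k' i' = ec k i := ⟨k, i, rfl⟩
    have hrk : rk (ec k i) = h.choose.2.1 h.choose_spec.choose := dif_pos h
    rw [hrk]
    have hspec := h.choose_spec.choose_spec
    generalize h.choose_spec.choose = i' at hspec ⊢
    generalize h.choose = k' at hspec i' ⊢
    obtain rfl : k' = k := by
      by_contra hne
      exact hcc k' k hne ((hspec ▸ (hnear k' i')).trans (hnear k i).symm |>.mono (by omega))
    rw [hρ i' i (((hec k').1.1 _ _ _ _ ⟨i', rfl, rfl⟩ ⟨i, rfl, rfl⟩).2 hspec)]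
  -- Everything not near a right-hand centre counts as left, including the surroundings of `R`.
  refine ⟨hfinX.toFinset, lev, fun a => ¬ ∃ k, k.2.2.2.1 = false ∧ Near L (K + H) (c k) a, rk,
    ?_, ?_⟩
  · rw [← Set.ncard_eq_toFinset_card _ hfinX]
    refine (ncard_inLayer_le hd H).trans (Nat.mul_le_mul_right _ (Nat.add_le_add hRcard ?_))
    rw [Nat.card_prod]
    exact Nat.mul_le_mul_right _ (Finite.card_subtype_le _)
  · refine ⟨fun a ha => hlev_le (hmem.1 ha), fun b => ?_, fun a ha hl a' haa' => ?_, ?_⟩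
    · have : InLayer L K R f c 0 b := Or.inl ⟨b, Or.inl ⟨b, rfl⟩, Near.refl _ _⟩
      exact ⟨hmem.2 (this.mono (Nat.zero_le _)), Nat.le_zero.1 (hlev_le this)⟩
    · have := (hlev (hmem.1 ha)).succ_of_adj haa'
      exact ⟨hmem.2 (this.mono hl), hlev_le this⟩
    · intro a ha
      have hτ : col a ∉ S := by
        intro h
        have : InLayer L K R f c 0 a := Or.inl ⟨a, Or.inr h, Near.refl _ _⟩
        exact ha (hmem.2 (this.mono (Nat.zero_le _))) (Nat.le_zero.1 (hlev_le this))
      refine ⟨a₀ ⟨col a, hτ⟩, e ⟨col a, hτ⟩, he _, hcol _ _ (ha₀ _), fun ρ hρ l hl P => ?_⟩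
      let key : Fin N → {τ // τ ∉ S} × J := fun t =>
        (⟨col a, hτ⟩, ρ, ⟨l, by omega⟩, decide P, t)
      have hinj : Function.Injective (c ∘ key) := by
        intro t t' h
        by_contra hne
        refine hcc (key t) (key t') (fun h' => hne ?_) ?_
        · exact congrArg (fun k => k.2.2.2.2) h'
        · rw [show c (key t) = c (key t') from h]
          exact Near.refl _ _
      refine ⟨Finset.univ.image (c ∘ key), ?_, ?_⟩
      · rw [Finset.card_image_of_injective _ hinj, Finset.card_univ, Fintype.card_fin]
      · intro z hz
        obtain ⟨t, -, rfl⟩ := Finset.mem_image.1 hz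
        refine ⟨ec (key t), hec (key t), fun i => ?_⟩
        have hin := inLayer_of_near (R := R) (f := f) (hnear (key t) i)
        refine ⟨hmem.2 (hin.mono (hf _)), le_antisymm (hlev_le hin) ?_, ?_, hrk (key t) hρ i⟩
        · by_contra hlt
          rw [not_le] at hlt
          exact not_inLayer_of_near hcR hcc (hnear (key t) i) hlt
            ((hlev_le hin).trans (hf _)) (hlev hin)
        · constructor
          · intro h
            by_contra hP
            exact h ⟨key t, by simp [key, hP], (hnear (key t) i).mono (by omega)⟩
          · rintro hP ⟨k', hk', hk''⟩
            refine hcc k' (key t) ?_ ((hk''.trans (hnear (key t) i).symm).mono (by omega))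
            rintro rfl
            simp [key, hP] at hk'

end Layout

/-! ### Orders with prescribed initial and final segments. -/

section Order

/-- The layer of level `l` in the initial or final segment, as an integer. -/
noncomputable def layer (H : ℕ) (left : Prop) (l : ℕ) : ℤ :=
  open Classical in if left then (l : ℤ) - (H + 1) else (H : ℤ) + 1 - l

/-- Sort lexicographically by layer, then `rk`: left layers are negative, right ones positive,
elements outside the range of `y` sit at `0`, and level `0` is outermost. The enumeration `g` only
separates elements outside the range. -/
theorem exists_layered_order {B : Type*} [Finite B] {ι Λ : Type*} [LinearOrder Λ] [Nonempty Λ]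
    {y : ι → B} (hy : Function.Injective y) {H : ℕ} {lev : ι → ℕ} (hlev : ∀ i, lev i ≤ H)
    (left : ι → Prop) {rk : ι → Λ} (hrk : Function.Injective rk) :
    ∃ s : B → B → Prop, IsStrictTotalOrder B s ∧
      (∀ i j, s (y i) (y j) ↔ toLex (layer H (left i) (lev i), rk i) <
        toLex (layer H (left j) (lev j), rk j)) ∧
      (∀ i b, left i → (∀ i', lev i' ≤ lev i → y i' ≠ b) → s (y i) b) ∧
      ∀ i b, ¬ left i → (∀ i', lev i' ≤ lev i → y i' ≠ b) → s b (y i) := by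
  classical
  obtain ⟨n, ⟨g⟩⟩ := Finite.exists_equiv_fin B
  let o : Λ := Classical.arbitrary Λ
  let key : B → (ℤ ×ₗ Λ) ×ₗ Fin n := fun b => toLex
    (if h : ∃ i, y i = b then toLex (layer H (left h.choose) (lev h.choose), rk h.choose)
      else toLex (0, o), g b)
  have hkey : Function.Injective key := by
    intro b b' h
    have := congrArg (fun z => (ofLex z).2) h
    exact g.injective this
  have hin : ∀ i, key (y i) = toLex (toLex (layer H (left i) (lev i), rk i), g (y i)) := by
    intro i
    have h : ∃ i', y i' = y i := ⟨i, rfl⟩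
    have hi : h.choose = i := hy h.choose_spec
    simp only [key, dif_pos h]
    rw [hi]
  have hout : ∀ b, (∀ i, y i ≠ b) → key b = toLex (toLex (0, o), g b) := by
    intro b hb
    have h : ¬ ∃ i', y i' = b := by simpa using hb
    simp only [key, dif_neg h]
  have hlt : ∀ {a b : ℤ} {x y : Λ} {m m' : Fin n}, a < b →
      toLex (toLex (a, x), m) < toLex (toLex (b, y), m') := by
    intro a b x y m m' hab
    exact Prod.Lex.toLex_lt_toLex.2 (Or.inl (Prod.Lex.toLex_lt_toLex.2 (Or.inl hab)))
  refine ⟨fun b b' => key b < key b', ?_, ?_, ?_, ?_⟩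
  · exact
      { trichotomous := fun a b h h' => hkey (le_antisymm (not_lt.1 h') (not_lt.1 h))
        irrefl := fun a => lt_irrefl (key a)
        trans := fun a b c => lt_trans (a := key a) }
  · intro i j
    change key (y i) < key (y j) ↔ _
    rw [hin, hin, Prod.Lex.toLex_lt_toLex]
    refine ⟨fun h => h.elim id fun h => ?_, Or.inl⟩
    have : i = j := hrk (congrArg (fun z => (ofLex z).2) h.1)
    subst this
    exact absurd h.2 (lt_irrefl _)
  · intro i b hi hb
    have h1 := hlev i
    by_cases h : ∃ j, y j = b
    · obtain ⟨j, rfl⟩ := h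
      have h2 : lev i < lev j := by
        by_contra h
        exact hb j (not_lt.1 h) rfl
      rw [hin, hin]
      apply hlt
      have h3 := hlev j
      simp only [layer, hi, if_true]
      split_ifs <;> omega
    · rw [hin, hout b (by simpa using h)]
      apply hlt
      simp only [layer, hi, if_true]
      omega
  · intro i b hi hb
    have h1 := hlev i
    by_cases h : ∃ j, y j = b
    · obtain ⟨j, rfl⟩ := h
      have h2 : lev i < lev j := by
        by_contra h
        exact hb j (not_lt.1 h) rfl
      rw [hin, hin]
      apply hlt
      have h3 := hlev j
      simp only [layer, hi, if_false]
      split_ifs <;> omega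
    · rw [hin, hout b (by simpa using h)]
      apply hlt
      simp only [layer, hi, if_false]
      omega

end Order

/-! ### Matching orders from a layout. -/

section Construction

variable {L : FirstOrder.Language.{u, v}} {A B G : Type w} [L.Structure A] [L.Structure B]
  [L.Structure G]

/-- The ranks of the entries of a tuple with respect to a strict total order. -/
theorem exists_rank {q : A → A → Prop} (hq : IsStrictTotalOrder A q) {m : ℕ} (e : Fin m → A) :
    ∃ ρ : Fin m → Fin m, ∀ i j, ρ i < ρ j ↔ q (e i) (e j) := by
  classical
  let T : Fin m → Finset (Fin m) := fun i => Finset.univ.filter fun k => q (e k) (e i)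
  have hT : ∀ i k, k ∈ T i ↔ q (e k) (e i) := fun i k => by simp [T]
  have hsub : ∀ i j, q (e i) (e j) → (T i).card < (T j).card := by
    intro i j h
    refine Finset.card_lt_card ⟨fun k hk => ?_, fun hle => ?_⟩
    · exact (hT _ _).2 (_root_.trans ((hT _ _).1 hk) h)
    · exact irrefl_of q (e i) ((hT _ _).1 (hle ((hT _ _).2 h)))
  refine ⟨fun i => ⟨(T i).card, ?_⟩, fun i j => ⟨fun h => ?_, fun h => hsub i j h⟩⟩
  · have : T i ⊂ Finset.univ := by
      refine Finset.ssubset_univ_iff.2 fun h => ?_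
      exact irrefl_of q (e i) ((hT _ _).1 (h ▸ Finset.mem_univ i))
    simpa using Finset.card_lt_card this
  · have h : (T i).card < (T j).card := h
    rcases trichotomous_of q (e i) (e j) with h' | h' | h'
    · exact h'
    · simp only [T, h'] at h
      omega
    · have := hsub j i h'
      omega

theorem localIso_of_rank {q : B → B → Prop} {t : G → G → Prop} (hq : IsStrictTotalOrder B q)
    (ht : IsStrictTotalOrder G t) {K m : ℕ} {e : Fin m → B} {g : Fin m → G}
    (hiso : IsPartialIso L fun x y => ∃ i, e i = x ∧ g i = y) {z : B} {z' : G}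
    (hz : ∃ i, e i = z ∧ g i = z') (he : ∀ b, Near L K z b ↔ ∃ i, e i = b)
    (hg : ∀ b, Near L K z' b ↔ ∃ i, g i = b) {ρ : Fin m → Fin m}
    (hρ : ∀ i j, ρ i < ρ j ↔ q (e i) (e j)) (hρ' : ∀ i j, ρ i < ρ j → t (g i) (g j)) :
    LocalIso L q t K z z' := by
  refine ⟨_, hz, ⟨hiso, ?_⟩, fun a' ha => ?_, fun b' hb => ?_⟩
  · rintro _ _ _ _ ⟨i, rfl, rfl⟩ ⟨j, rfl, rfl⟩
    refine ⟨fun h => hρ' i j ((hρ i j).2 h), fun h => ?_⟩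
    rcases trichotomous_of q (e i) (e j) with h' | h' | h'
    · exact h'
    · rw [(hiso.1 _ _ _ _ ⟨i, rfl, rfl⟩ ⟨j, rfl, rfl⟩).1 h'] at h
      exact absurd h (irrefl_of t _)
    · exact absurd h (asymm_of t (hρ' j i ((hρ j i).2 h')))
  · obtain ⟨i, rfl⟩ := (he a').1 ha
    exact ⟨_, i, rfl, rfl⟩
  · obtain ⟨i, rfl⟩ := (hg b').1 hb
    exact ⟨_, i, rfl, rfl⟩

theorem Enumerates.comp_iso {K m : ℕ} {e : Fin m → A} {a : A} {z : B} {e' : Fin m → B}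
    (h : Enumerates L K e a z e') {z' : G} {g : Fin m → G}
    (hg : IsPartialIso L fun x y => ∃ i, e i = x ∧ g i = y) (hz : ∀ i, e i = a → g i = z') :
    (IsPartialIso L fun x y => ∃ i, e' i = x ∧ g i = y) ∧ ∃ i, e' i = z ∧ g i = z' := by
  refine ⟨(h.1.flip.comp hg).mono ?_, ?_⟩
  · rintro _ _ ⟨i, rfl, rfl⟩
    exact ⟨e i, ⟨i, rfl, rfl⟩, i, rfl, rfl⟩
  · obtain ⟨i, h1, h2⟩ := h.2.1
    exact ⟨i, h2, hz i h1⟩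

/-- Two structures with a common layout have orders that match. -/
theorem Layout.exists_matching [Finite A] [Nonempty A] [Finite B] [Nonempty B] {d K N m k : ℕ}
    (hk : ∀ n, Nonempty (L.Relations n) → n ≤ k)
    (hdA : ∀ a : A, ((gaifmanGraph L A).neighborSet a).ncard ≤ d)
    (hdB : ∀ b : B, ((gaifmanGraph L B).neighborSet b).ncard ≤ d)
    {X : Finset A} {lev : A → ℕ} {left : A → Prop} {rk : A → ℕ}
    (Y : Layout L K (N + d) m (m + (k + 1)) X lev left rk)
    (h : BackForth L (X.card + (m + (k + 1) + 1)) (constRel L A B)) :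
    ∃ (r : A → A → Prop) (s : B → B → Prop) (x : X → A) (y : X → B) (lev : X → ℕ)
      (left : X → Prop), Matching L r s K N d x y lev left := by
  classical
  -- After `X` is copied, one round remains to pair an arbitrary point, `m` to enumerate its ball
  -- and `k + 1` to preserve adjacency.
  obtain ⟨f, hf⟩ := h.exists_fun X le_rfl
  set p : A → B → Prop := fun a b => constRel L A B a b ∨ (a ∈ X ∧ b = f a) with hp
  have hfX : ∀ a ∈ X, p a (f a) := fun a ha => Or.inr ⟨ha, rfl⟩
  have hpX : ∀ a b, p a b → a ∈ X := by
    rintro a b (⟨c, rfl, rfl⟩ | h)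
    · exact (Y.const c).1
    · exact h.1
  have hpf : ∀ a b, p a b → f a = b := fun a b hab =>
    (hf.isPartialIso.1 _ _ _ _ (hfX a (hpX a b hab)) hab).1 rfl
  let x : X → A := Subtype.val
  let y : X → B := fun i => f i
  have hx : Function.Injective x := Subtype.val_injective
  have hy : Function.Injective y := fun i j hij =>
    Subtype.ext ((hf.isPartialIso.1 _ _ _ _ (hfX i i.2) (hfX j j.2)).2 hij)
  obtain ⟨n, ⟨g⟩⟩ := Finite.exists_equiv_fin A
  -- The same key sorts `X` and its copy, tie-breaks included, so the two orders agree on them.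
  let rk' : X → ℕ ×ₗ Fin n := fun i => toLex (rk i, g i)
  have hrk' : Function.Injective rk' := fun i j hij =>
    Subtype.ext (g.injective (congrArg (fun z => (ofLex z).2) hij))
  have : Nonempty (ℕ ×ₗ Fin n) := (‹Nonempty A›).map fun a => toLex (0, g a)
  have hlevX : ∀ i : X, lev i ≤ 2 * K + 3 := fun i => Y.lev_le i i.2
  obtain ⟨r, hr, hr1, hr2, hr3⟩ := exists_layered_order hx hlevX (fun i => left i) hrk'
  obtain ⟨s, hs, hs1, hs2, hs3⟩ := exists_layered_order hy hlevX (fun i => left i) hrk'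
  have hrs : ∀ i j, r (x i) (x j) ↔ s (y i) (y j) := fun i j => (hr1 i j).trans (hs1 i j).symm
  have hrrk : ∀ i j : X, lev i = lev j → (left i ↔ left j) → rk i < rk j → r (x i) (x j) := by
    intro i j h1 h2 h3
    rw [hr1, h1, propext h2]
    exact Prod.Lex.toLex_lt_toLex.2 (Or.inr ⟨rfl, Prod.Lex.toLex_lt_toLex.2 (Or.inl h3)⟩)
  -- Stated for any ordered `C` so as to serve both `A` and `B`. The order `q` may depend on `X`:
  -- the layout already provides for every order of the ball.
  have hrich : ∀ {C : Type w} [L.Structure C] [Nonempty C] (q : C → C → Prop),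
      IsStrictTotalOrder C q → ∀ (z : C) (a : A), (a ∈ X → lev a ≠ 0) → ∀ p' : A → C → Prop,
      BackForth L (m + (k + 1)) p' → p' a z → ∀ l ≤ K + 3, ∀ S : Prop,
      ∃ F : Finset X, N + d ≤ F.card ∧ ∀ i ∈ F, lev i = l ∧ (left i ↔ S) ∧
        LocalIso L q r K z (x i) ∧ LocalIso L q s K z (y i) := by
    intro C _ _ q hq z a ha p' hp' haz l hl S
    obtain ⟨a₀, e, he, ⟨p₀, hp₀, hp₀a⟩, hrich⟩ := Y.rich a ha
    obtain ⟨ez, hez⟩ := (hp₀.comp hp').exists_enumerates hk he ⟨a, hp₀a, haz⟩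
    obtain ⟨ρ, hρ⟩ := exists_rank hq ez
    have hcompat : ∀ i i', e i = e i' → ρ i = ρ i' := by
      intro i i' hii
      have hzz := (hez.1.1 _ _ _ _ ⟨i, rfl, rfl⟩ ⟨i', rfl, rfl⟩).1 hii
      refine le_antisymm (not_lt.1 fun h => ?_) (not_lt.1 fun h => ?_)
      · rw [hρ, hzz] at h
        exact irrefl_of q _ h
      · rw [hρ, hzz] at h
        exact irrefl_of q _ h
    obtain ⟨F, hF, hF'⟩ := hrich ρ hcompat l hl S
    have hFX : ∀ a ∈ F, a ∈ X ∧ lev a = l ∧ (left a ↔ S) := by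
      intro a ha
      obtain ⟨e', he', h'⟩ := hF' a ha
      obtain ⟨i, -, rfl⟩ := he'.2.1
      exact ⟨(h' i).1, (h' i).2.1, (h' i).2.2.1⟩
    refine ⟨F.subtype (· ∈ X), ?_, ?_⟩
    · rwa [Finset.card_subtype, Finset.filter_true_of_mem fun a ha => (hFX a ha).1]
    · intro i hi
      rw [Finset.mem_subtype] at hi
      obtain ⟨e', he', h'⟩ := hF' i hi
      have hlt : ∀ j j', ρ j < ρ j' → r (e' j) (e' j') := by
        intro j j' hjj
        refine hrrk ⟨e' j, (h' j).1⟩ ⟨e' j', (h' j').1⟩ ((h' j).2.1.trans (h' j').2.1.symm)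
          ((h' j).2.2.1.trans (h' j').2.2.1.symm) ?_
        change rk (e' j) < rk (e' j')
        rw [(h' j).2.2.2, (h' j').2.2.2]
        exact hjj
      have hroot : ∀ j, e j = a₀ → e' j = i := by
        intro j hj
        obtain ⟨j', h1, h2⟩ := he'.2.1
        rw [← h2]
        exact (he'.1.1 _ _ _ _ ⟨j, rfl, rfl⟩ ⟨j', rfl, rfl⟩).1 (hj.trans h1.symm)
      refine ⟨(hFX i hi).2.1, (hFX i hi).2.2, ?_, ?_⟩
      · obtain ⟨h1, h2⟩ := hez.comp_iso he'.1 hroot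
        exact localIso_of_rank hq hr h1 h2 hez.2.2 he'.2.2 hρ hlt
      · have hfe : IsPartialIso L fun x y => ∃ j, e j = x ∧ (f ∘ e') j = y := by
          refine (he'.1.comp hf.isPartialIso).mono ?_
          rintro _ _ ⟨j, rfl, rfl⟩
          exact ⟨e' j, ⟨j, rfl, rfl⟩, hfX _ (h' j).1⟩
        obtain ⟨h1, h2⟩ := hez.comp_iso (z' := f i) hfe
          fun j hj => congrArg f (hroot j hj)
        refine localIso_of_rank hq hs h1 h2 hez.2.2 (fun b => ⟨fun hb => ?_, ?_⟩) hρ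
          fun j j' hjj => (hrs ⟨e' j, (h' j).1⟩ ⟨e' j', (h' j').1⟩).1 (hlt j j' hjj)
        -- The remaining rounds make `f` carry the ball around `i` onto the ball around `f i`.
        · obtain ⟨c, hc, hc'⟩ := hf.exists_near hk (by omega) (hfX i i.2) (fun c hc => by
            obtain ⟨j, rfl⟩ := (he'.2.2 c).1 hc
            exact ⟨_, hfX _ (h' j).1⟩) hb
          obtain ⟨j, rfl⟩ := (he'.2.2 c).1 hc'
          exact ⟨j, hpf _ _ hc⟩
        · rintro ⟨j, rfl⟩
          have hnear := (he'.2.2 (e' j)).2 ⟨j, rfl⟩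
          obtain ⟨b, hb, hb'⟩ := hf.flip.exists_near hk (by omega) (hfX i i.2) (fun c hc => by
            obtain ⟨c', hc', -⟩ := hf.exists_near hk (by omega) (hfX i i.2) (fun c hc => by
              obtain ⟨j, rfl⟩ := (he'.2.2 c).1 hc
              exact ⟨_, hfX _ (h' j).1⟩) hc
            exact ⟨c', hc'⟩) hnear
          rw [Function.comp_apply, hpf _ _ hb]
          exact hb'
  refine ⟨r, s, x, y, fun i => lev i, fun i => left i, ?_⟩
  exact
    { order_x := hr
      order_y := hs
      degree_x := hdA
      degree_y := hdB
      injective := hx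
      iso := by
        refine ⟨hf.isPartialIso.mono ?_, ?_⟩
        · rintro _ _ ⟨i, rfl, rfl⟩
          exact hfX i i.2
        · rintro _ _ _ _ ⟨i, rfl, rfl⟩ ⟨j, rfl, rfl⟩
          exact hrs i j
      const := fun c => ⟨⟨c, (Y.const c).1⟩, (Y.const c).2, rfl, hpf _ _ (Or.inl ⟨c, rfl, rfl⟩)⟩
      closed_x := fun i a hi ha => by
        obtain ⟨h1, h2⟩ := Y.closed i i.2 hi a ha
        exact ⟨⟨a, h1⟩, rfl, h2⟩
      closed_y := fun i b hi hb => by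
        obtain ⟨a, ha, ha'⟩ := hf.exists_adj hk (by omega) (hfX i i.2)
          (fun c hc => ⟨_, hfX c (Y.closed i i.2 hi c hc).1⟩) hb
        obtain ⟨h1, h2⟩ := Y.closed i i.2 hi a ha'
        exact ⟨⟨a, h1⟩, hpf _ _ ha, h2⟩
      left_x := hr2
      left_y := hs2
      right_x := hr3
      right_y := hs3
      rich_x := fun a ha l hl S => by
        have ha' : a ∈ X → lev a ≠ 0 := fun h h' => ha ⟨a, h⟩ h' rfl
        obtain ⟨b, hb⟩ := (hf.of_le (m := m + (k + 1) + 1) le_rfl).2.1 a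
        -- Going to `B` and back yields a position from `A` to itself that relates `a` to `a`.
        obtain ⟨F, hF, hF'⟩ := hrich r hr a a ha' _ (hb.comp hb.flip)
          ⟨b, Or.inr ⟨rfl, rfl⟩, Or.inr ⟨rfl, rfl⟩⟩ l hl S
        exact ⟨F, hF, fun i hi => ⟨(hF' i hi).1, (hF' i hi).2.1, (hF' i hi).2.2.2⟩⟩
      rich_y := fun b hb l hl S => by
        obtain ⟨a, ha⟩ := (hf.of_le (m := m + (k + 1) + 1) le_rfl).2.2 b
        have ha' : a ∈ X → lev a ≠ 0 := fun h h' => hb ⟨a, h⟩ h'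
          ((ha.isPartialIso.1 _ _ _ _ (Or.inl (hfX a h)) (Or.inr ⟨rfl, rfl⟩)).1 rfl)
        obtain ⟨F, hF, hF'⟩ := hrich s hs b a ha' _ ha (Or.inr ⟨rfl, rfl⟩) l hl S
        exact ⟨F, hF, fun i hi => ⟨(hF' i hi).1, (hF' i hi).2.1, (hF' i hi).2.2.1⟩⟩ }

end Construction

/-! ### Choice of parameters and conclusion. -/

section Definability

variable {L : FirstOrder.Language.{u, v}}

theorem exists_arity_bound (hfin : Finite L.Symbols) :
    ∃ k, ∀ n, Nonempty (L.Relations n) → n ≤ k := by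
  have : Finite (Σ n, L.Relations n) := Finite.of_injective
    (fun c => (Sum.inr c : L.Symbols)) Sum.inr_injective
  obtain ⟨k, hk⟩ := (Set.finite_range fun R : Σ n, L.Relations n => R.1).bddAbove
  exact ⟨k, fun n ⟨R⟩ => hk ⟨⟨n, R⟩, rfl⟩⟩

/-- In bounded degree, structures that agree on finitely many first-order sentences have orders
whose expansions agree on a given sentence of `C²`. -/
theorem exists_finite_orders (hfin : Finite L.Symbols)
    (hconst : ∀ n : ℕ, IsEmpty (L.Functions (n + 1))) (d : ℕ) (φ : CtwoSentence (withLt L)) :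
    ∃ S : Set L.Sentence, S.Finite ∧ ∀ A B : FinStructure.{u, v, w} L,
      (∀ a, ((gaifmanGraph L A.Carrier).neighborSet a).ncard ≤ d) →
      (∀ b, ((gaifmanGraph L B.Carrier).neighborSet b).ncard ≤ d) →
      (∀ θ ∈ S, A.Carrier ⊨ θ ↔ B.Carrier ⊨ θ) →
      ∃ (r : A.Carrier → A.Carrier → Prop) (s : B.Carrier → B.Carrier → Prop),
        IsStrictTotalOrder A.Carrier r ∧ IsStrictTotalOrder B.Carrier s ∧
        (RealizeWith A r φ ↔ RealizeWith B s φ) := by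
  obtain ⟨k, hk⟩ := exists_arity_bound hfin
  set K := φ.1.rank + 2
  -- The added `1` guarantees an answer even when `φ` counts nothing.
  set N := φ.1.maxCount + 1
  obtain ⟨n₀, hn₀⟩ := exists_layout.{u, v, w} hfin d K (N + d) k hk (by omega)
  obtain ⟨S, hS, hback⟩ := exists_finite_backForth.{u, v, w} hfin
    (n₀ + ((d + 1) ^ K + (k + 1) + 1)) 0
  refine ⟨S, hS, fun A B hA hB hAB => ?_⟩
  obtain ⟨X, lev, left, rk, hX, Y⟩ := hn₀ A.Carrier hA
  have h := (hback A.Carrier B.Carrier default default hAB).mono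
    (p := constRel L A.Carrier B.Carrier) fun _ _ => Or.inl
  obtain ⟨r, s, x, y, lev', left', M⟩ := Y.exists_matching hk hA hB (h.of_le (by omega))
  exact ⟨r, s, M.order_x, M.order_y,
    M.realize_forall_iff hconst φ.1 le_rfl (by omega) (by omega)⟩

end Definability

end OrderInvariant

theorem theorem2 (L : FirstOrder.Language.{u, v}) (hfin : Finite L.Symbols)
    (hconst : ∀ n : ℕ, IsEmpty (L.Functions (n + 1)))
    (C : Set (OrderInvariant.FinStructure.{u, v, w} L))
    (hC : OrderInvariant.BoundedDegree C)
    (P : Set (OrderInvariant.FinStructure.{u, v, w} L))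
    (hP : OrderInvariant.DefinableOrderInvariantCtwo C P) :
    OrderInvariant.DefinableFO C P := by
  obtain ⟨d, hd⟩ := hC
  obtain ⟨φ, hφ, rfl⟩ := hP
  obtain ⟨S, hS, hAB⟩ := OrderInvariant.exists_finite_orders.{u, v, w} hfin hconst d φ
  refine OrderInvariant.definableFO_of_finite (fun A hA => hA.1) hS ?_
  rintro A hA B hB hθ ⟨-, hAφ⟩
  obtain ⟨r, s, hr, hs, hrs⟩ := hAB A B (hd A hA) (hd B hB) hθ
  -- Invariance carries truth from the constructed order `s` to every other order on `B`.
  exact ⟨hB, fun s' hs' => (hφ B s s' hs hs').1 (hrs.1 (hAφ r hr))⟩
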